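/- Let $\Pi=\{z\in\mathbb C:\operatorname{Im}z>0\}$ with area measure $dx\,dy$, let $\mathcal A^2(\Pi)$ be the Bergman space of holomorphic functions in $L_2(\Pi)$, and let $B:L_2(\Pi)\to\mathcal A^2(\Pi)$ be the orthogonal projection. For bounded measurable $a$ on $\Pi$ let $T_a:\mathcal A^2(\Pi)\to\mathcal A^2(\Pi)$, $T_af=B(af)$, be the Toeplitz operator with symbol $a$. Fix $n\ge 1$ and put $a_k(z)=\chi_{[k-1,k)}(\operatorname{Im}z)$ for $1\le k\le n-1$ and $a_n(z)=\chi_{[n-1,\infty)}(\operatorname{Im}z)$. The operators $T_{a_k}$ are positive; let $$P_T=\bigl(\sqrt{T_{a_j}}\,\sqrt{T_{a_k}}\bigr)_{j,k=1,\dots,n}:(\mathcal A^2(\Pi))^n\to(\mathcal A^2(\Pi))^n ,$$ which is an orthogonal projection. Its image is a reproducing kernel Hilbert space of $\mathbb C^n$-valued functions on $\Pi$; let $\mathbf K(z,w)=(K_{jk}(z,w))_{j,k=1,\dots,n}$ be its reproducing kernel, i.e. for all $w\in\Pi$, $c\in\mathbb C^n$ the function $\mathbf K(\cdot,w)c$ belongs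 to the image and $\langle f,\mathbf K(\cdot,w)c\rangle=\langle f(w),c\rangle_{\mathbb C^n}$ for every $f$ in the image (inner products linear in the first argument). For $m\in\mathbb Z$ let $$G_m(z,w)=\frac{-1}{\pi\,[z-\overline w+mi]^2},$$ and for $\operatorname{Re}p>0$ let $$J(p)=\int_0^\infty e^{-pt}(1-e^{-2t})^{1/2}\,dt,\qquad \beta(p)=\int_0^\infty\frac{e^{-pt}}{1+e^{-t}}\,dt$$ ($\beta$ is Nielsen's beta function). Let $H(z)=\psi(z+1)+\gamma$, where $\psi=\Gamma'/\Gamma$ is the digamma function and $\gamma$ the Euler--Mascheroni constant. **Theorem.** For all $z,w\in\Pi$: 1. $K_{nn}(z,w)=G_{2(n-1)}(z,w)$. 2. $K_{jk}(z,w)=-G_{j+k}(z,w)+G_{j+k-2}(z,w)$ for $j,k=1,\dots,n-1$. 3. For $j=1,\dots,n-1$, with $p=-i(z-\overline w)+j+(n-2)$, $$K_{jn}(z,w)=\frac1\pi J(p)\Bigl(\beta(p)+\frac1{p+1}\Bigr)=\frac{J(p)}{2\pi}\Bigl[H\Bigl(\frac{p+1}2\Bigr)-H\Bigl(\frac p2\Bigr)+\frac2p\Bigr],\qquad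 J(p)=\frac{\sqrt\pi}{4}\,\frac{\Gamma(p/2)}{\Gamma\left(\frac p2+\frac32\right)},$$ and $K_{nj}(z,w)=K_{jn}(z,w)$. -/

import Mathlib

open MeasureTheory UpperHalfPlane
open scoped ENNReal ComplexConjugate InnerProductSpace

noncomputable section

/-- Area measure `dx dy` on the upper half-plane. -/
abbrev areaMeasure : Measure ℂ := volume.restrict upperHalfPlaneSet

/-- Two holomorphic functions on the upper half-plane that agree almost everywhere agree. -/
theorem eqOn_of_ae_eq_areaMeasure {F G : ℂ → ℂ} (hF : DifferentiableOn ℂ F upperHalfPlaneSet)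
    (hG : DifferentiableOn ℂ G upperHalfPlaneSet) (h : F =ᵐ[areaMeasure] G) :
    Set.EqOn F G upperHalfPlaneSet :=
  Measure.eqOn_open_of_ae_eq h isOpen_upperHalfPlaneSet hF.continuousOn hG.continuousOn

theorem ofReal_mul_enorm_le_circle {F : ℂ → ℂ} {z : ℂ} {s : ℝ} (hs : 0 < s)
    (hF : DifferentiableOn ℂ F (Metric.closedBall z s)) :
    ENNReal.ofReal (2 * Real.pi) * ‖F z‖ₑ ≤
      ∫⁻ θ in Set.Ioo (-Real.pi) Real.pi, ‖F (circleMap z s θ)‖ₑ := by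
  have h1 : Real.circleAverage F z s = F z := by
    apply DiffContOnCl.circleAverage
    rw [abs_of_pos hs]
    apply DifferentiableOn.diffContOnCl
    rwa [closure_ball _ hs.ne']
  have hper : Function.Periodic (fun θ => F (circleMap z s θ)) (2 * Real.pi) := fun θ => by
    simp [periodic_circleMap z s θ]
  have h2 : (∫ θ in (-Real.pi)..Real.pi, F (circleMap z s θ)) = (2 * Real.pi : ℝ) • F z := by
    have := hper.intervalIntegral_add_eq (-Real.pi) 0
    rw [zero_add, show -Real.pi + 2 * Real.pi = Real.pi by ring] at this
    rw [this, ← h1, Real.circleAverage_def, smul_smul, mul_inv_cancel₀ (by positivity), one_smul]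
  have h3 : ENNReal.ofReal (2 * Real.pi) * ‖F z‖ₑ =
      ‖∫ θ in (-Real.pi)..Real.pi, F (circleMap z s θ)‖ₑ := by
    rw [h2, enorm_smul, Real.enorm_eq_ofReal (by positivity)]
  rw [h3, intervalIntegral.integral_of_le (by linarith [Real.pi_pos]),
    integral_Ioc_eq_integral_Ioo]
  exact enorm_integral_le_lintegral_enorm _

theorem ofReal_mul_enorm_le_ball {F : ℂ → ℂ} {z : ℂ} {r : ℝ} (hr : 0 < r)
    (hF : DifferentiableOn ℂ F (Metric.ball z r)) :
    ENNReal.ofReal (Real.pi * r ^ 2) * ‖F z‖ₑ ≤ ∫⁻ w in Metric.ball z r, ‖F w‖ₑ := by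
  classical
  set g : ℂ → ℝ≥0∞ := (Metric.ball z r).indicator fun w => ‖F w‖ₑ with hg
  have hgm : Measurable g := by
    rw [hg, ← Set.piecewise_eq_indicator]
    exact ContinuousOn.measurable_piecewise hF.continuousOn.enorm continuousOn_const
      Metric.isOpen_ball.measurableSet
  have e1 : ∫⁻ w in Metric.ball z r, ‖F w‖ₑ = ∫⁻ w, g (w + z) := by
    rw [lintegral_add_right_eq_self (μ := volume) g z,
      lintegral_indicator Metric.isOpen_ball.measurableSet]
  have hpc : ∀ s θ : ℝ, Complex.polarCoord.symm (s, θ) + z = circleMap z s θ := fun s θ => by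
    rw [Complex.polarCoord_symm_apply, circleMap, Complex.exp_mul_I]
    push_cast
    ring
  have hm : Measurable fun p : ℝ × ℝ => ENNReal.ofReal p.1 * g (circleMap z p.1 p.2) := by
    have hc : Continuous fun p : ℝ × ℝ => circleMap z p.1 p.2 := by
      unfold circleMap; fun_prop
    exact (ENNReal.measurable_ofReal.comp measurable_fst).mul (hgm.comp hc.measurable)
  have e2 : ∫⁻ w, g (w + z) = ∫⁻ s in Set.Ioi (0 : ℝ), ∫⁻ θ in Set.Ioo (-Real.pi) Real.pi,
      ENNReal.ofReal s * g (circleMap z s θ) := by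
    rw [← Complex.lintegral_comp_polarCoord_symm, polarCoord_target, Measure.volume_eq_prod,
      ← Measure.prod_restrict, ← lintegral_prod _ hm.aemeasurable]
    simp only [← hpc, smul_eq_mul]
  have e3 : ∫⁻ s in Set.Ioo (0 : ℝ) r, ENNReal.ofReal s = ENNReal.ofReal (r ^ 2 / 2) := by
    rw [← ofReal_integral_eq_lintegral_ofReal]
    · rw [← integral_Ioc_eq_integral_Ioo, ← intervalIntegral.integral_of_le hr.le, integral_id]
      simp
    · exact (continuous_id.integrableOn_Icc).mono_set Set.Ioo_subset_Icc_self
    · exact (ae_restrict_mem measurableSet_Ioo).mono fun s hs => hs.1.le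
  rw [e1, e2]
  calc ENNReal.ofReal (Real.pi * r ^ 2) * ‖F z‖ₑ
      = ∫⁻ s in Set.Ioo (0 : ℝ) r, ENNReal.ofReal s * (ENNReal.ofReal (2 * Real.pi) * ‖F z‖ₑ) := by
        rw [lintegral_mul_const _ ENNReal.measurable_ofReal, e3, ← mul_assoc,
          ← ENNReal.ofReal_mul (by positivity)]
        congr 2
        ring
    _ ≤ ∫⁻ s in Set.Ioo (0 : ℝ) r, ∫⁻ θ in Set.Ioo (-Real.pi) Real.pi,
          ENNReal.ofReal s * g (circleMap z s θ) := by
        refine setLIntegral_mono' measurableSet_Ioo fun s hs => ?_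
        have hc : Measurable fun θ => g (circleMap z s θ) :=
          hgm.comp (continuous_circleMap z s).measurable
        rw [lintegral_const_mul _ hc]
        gcongr
        refine (ofReal_mul_enorm_le_circle hs.1
          (hF.mono (Metric.closedBall_subset_ball hs.2))).trans (le_of_eq ?_)
        refine lintegral_congr fun θ => ?_
        rw [hg, Set.indicator_of_mem]
        exact Metric.closedBall_subset_ball hs.2 (circleMap_mem_closedBall z hs.1.le θ)
    _ ≤ _ := lintegral_mono_set Set.Ioo_subset_Ioi_self

theorem enorm_le_eLpNorm {F : ℂ → ℂ} (hF : DifferentiableOn ℂ F upperHalfPlaneSet)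
    {z : ℂ} (hz : 0 < z.im) :
    ‖F z‖ₑ ≤ ENNReal.ofReal (z.im)⁻¹ * eLpNorm F 2 areaMeasure := by
  have hsub : Metric.ball z z.im ⊆ upperHalfPlaneSet := fun w hw => by
    have h1 := (Complex.abs_im_le_norm (w - z)).trans_lt (mem_ball_iff_norm.1 hw)
    have h2 := (abs_lt.1 h1).1
    rw [Complex.sub_im] at h2
    show 0 < w.im
    linarith
  have hb := ofReal_mul_enorm_le_ball hz (hF.mono hsub)
  have h1 : ∫⁻ w in Metric.ball z z.im, ‖F w‖ₑ ≤
      eLpNorm F 2 areaMeasure * ENNReal.ofReal (Real.pi * z.im ) := by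
    have hae : AEStronglyMeasurable F (volume.restrict (Metric.ball z z.im)) :=
      (hF.mono hsub).continuousOn.aestronglyMeasurable Metric.isOpen_ball.measurableSet
    have h := eLpNorm_le_eLpNorm_mul_rpow_measure_univ (p := 1) (q := 2) (by norm_num) hae
    rw [eLpNorm_one_eq_lintegral_enorm] at h
    refine h.trans ?_
    gcongr
    · exact Measure.restrict_mono hsub le_rfl
    · rw [Measure.restrict_apply_univ, Complex.volume_ball]
      have hv : ENNReal.ofReal z.im ^ 2 * (NNReal.pi : ℝ≥0∞) ≤
          ENNReal.ofReal (Real.pi * z.im) ^ 2 := by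
        rw [ENNReal.ofReal_mul Real.pi_pos.le, mul_pow, mul_comm]
        gcongr
        rw [← NNReal.coe_real_pi, ENNReal.ofReal_coe_nnreal, ← ENNReal.coe_pow]
        norm_cast
        rw [← NNReal.coe_le_coe, NNReal.coe_pow, NNReal.coe_real_pi]
        nlinarith [Real.pi_gt_three]
      refine (ENNReal.rpow_le_rpow hv (by norm_num)).trans (le_of_eq ?_)
      rw [← ENNReal.rpow_natCast, ← ENNReal.rpow_mul]
      norm_num
  have hp : (0 : ℝ) < Real.pi * z.im := by positivity
  have h2 := hb.trans h1
  rw [show Real.pi * z.im ^ 2 = (Real.pi * z.im) * z.im by ring,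
    ENNReal.ofReal_mul hp.le, mul_assoc, mul_comm (eLpNorm F 2 areaMeasure),
    ENNReal.mul_le_mul_iff_right (by simpa using hp) ENNReal.ofReal_ne_top] at h2
  rw [ENNReal.ofReal_inv_of_pos hz, mul_comm, ← div_eq_mul_inv,
    ENNReal.le_div_iff_mul_le (by simp [hz]) (by simp), mul_comm]
  exact h2

/-- The Bergman space of the upper half-plane, as a subspace of `L²`. -/
def bergmanSubmodule : Submodule ℂ (Lp ℂ 2 areaMeasure) where
  carrier := {f | ∃ F : ℂ → ℂ, DifferentiableOn ℂ F upperHalfPlaneSet ∧ f =ᵐ[areaMeasure] F}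
  zero_mem' := ⟨0, differentiableOn_const 0, Lp.coeFn_zero _ _ _⟩
  add_mem' := by
    rintro f g ⟨F, hF, hf⟩ ⟨G, hG, hg⟩
    exact ⟨F + G, hF.add hG, (Lp.coeFn_add f g).trans (hf.add hg)⟩
  smul_mem' := by
    rintro c f ⟨F, hF, hf⟩
    exact ⟨c • F, hF.const_smul c, (Lp.coeFn_smul c f).trans (hf.const_smul c)⟩

theorem isClosed_bergmanSubmodule : IsClosed (bergmanSubmodule : Set (Lp ℂ 2 areaMeasure)) := by
  refine isClosed_of_closure_subset fun f hf => ?_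
  obtain ⟨u, hu, hlim⟩ := mem_closure_iff_seq_limit.1 hf
  choose F hF hFu using hu
  have hbound : ∀ m k : ℕ, ∀ z : ℂ, 0 < z.im → dist (F m z) (F k z) ≤ (z.im)⁻¹ * dist (u m) (u k) := by
    intro m k z hz
    have h := enorm_le_eLpNorm ((hF m).sub (hF k)) hz
    rw [← eLpNorm_congr_ae ((Lp.coeFn_sub (u m) (u k)).trans ((hFu m).sub (hFu k))),
      ← Lp.enorm_def, ← ofReal_norm, ← ofReal_norm, ← ENNReal.ofReal_mul (by positivity),
      ENNReal.ofReal_le_ofReal_iff (by positivity)] at h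
    rw [dist_eq_norm, dist_eq_norm]
    exact h
  have hcu : CauchySeq u := hlim.cauchySeq
  have hcau : ∀ c : ℝ, 0 < c → UniformCauchySeqOn F Filter.atTop {z | c < z.im} := by
    intro c hc
    rw [Metric.uniformCauchySeqOn_iff]
    intro ε hε
    obtain ⟨N, hN⟩ := Metric.cauchySeq_iff.1 hcu (c * ε) (by positivity)
    refine ⟨N, fun m hm k hk z hz => ?_⟩
    have hz0 : 0 < z.im := hc.trans hz
    refine (hbound m k z hz0).trans_lt ?_
    rw [inv_mul_lt_iff₀ hz0]
    exact (hN m hm k hk).trans_le (by gcongr; exact hz.le)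
  have hex : ∀ z : ℂ, 0 < z.im → ∃ l, Filter.Tendsto (fun m => F m z) Filter.atTop (nhds l) := by
    intro z hz
    exact cauchySeq_tendsto_of_complete
      ((hcau (z.im / 2) (by positivity)).cauchySeq (x := z) (by simpa using hz))
  classical
  let G : ℂ → ℂ := fun z => if h : 0 < z.im then (hex z h).choose else 0
  have hG : ∀ z : ℂ, 0 < z.im → Filter.Tendsto (fun m => F m z) Filter.atTop (nhds (G z)) := by
    intro z hz
    simp only [G, dif_pos hz]
    exact (hex z hz).choose_spec
  refine ⟨G, ?_, ?_⟩
  · have hloc : TendstoLocallyUniformlyOn F G Filter.atTop upperHalfPlaneSet := by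
      intro v hv z hz
      have hz0 : 0 < z.im := hz
      have hopen : IsOpen {w : ℂ | z.im / 2 < w.im} :=
        isOpen_lt continuous_const Complex.continuous_im
      have hmem : z ∈ {w : ℂ | z.im / 2 < w.im} := by
        simpa using hz0
      refine ⟨{w : ℂ | z.im / 2 < w.im}, mem_nhdsWithin_of_mem_nhds (hopen.mem_nhds hmem), ?_⟩
      refine (hcau (z.im / 2) (by positivity)).tendstoUniformlyOn_of_tendsto (fun w hw => ?_) v hv
      have hw' : z.im / 2 < w.im := hw
      exact hG w (by linarith)
    exact hloc.differentiableOn (Filter.Eventually.of_forall hF) isOpen_upperHalfPlaneSet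
  · obtain ⟨ns, hns, hae⟩ := (tendstoInMeasure_of_tendsto_Lp hlim).exists_seq_tendsto_ae
    have hall : ∀ᵐ z ∂areaMeasure, ∀ m, u m z = F m z := ae_all_iff.2 hFu
    filter_upwards [hae, hall, ae_restrict_mem isOpen_upperHalfPlaneSet.measurableSet]
      with z h1 h2 h3
    simp only [h2] at h1
    exact tendsto_nhds_unique h1 ((hG z h3).comp hns.tendsto_atTop)

/-- The Bergman space `A²(Π)` of the upper half-plane, a Hilbert space with the inner product
of `L²(Π)`. -/
def Bergman : Type := bergmanSubmodule

instance : NormedAddCommGroup Bergman := inferInstanceAs (NormedAddCommGroup bergmanSubmodule)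

instance : InnerProductSpace ℂ Bergman := inferInstanceAs (InnerProductSpace ℂ bergmanSubmodule)

instance : CompleteSpace bergmanSubmodule := isClosed_bergmanSubmodule.completeSpace_coe

instance : CompleteSpace Bergman := inferInstanceAs (CompleteSpace bergmanSubmodule)

/-- The inclusion `A²(Π) → L²(Π)`. -/
def bergmanIncl : Bergman →L[ℂ] Lp ℂ 2 areaMeasure := bergmanSubmodule.subtypeL

/-- The orthogonal projection `B : L²(Π) → A²(Π)`. -/
def bergmanProj : Lp ℂ 2 areaMeasure →L[ℂ] Bergman := bergmanSubmodule.orthogonalProjectionOnto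

theorem inner_bergmanProj (f : Lp ℂ 2 areaMeasure) (g : Bergman) :
    ⟪bergmanProj f, g⟫_ℂ = ⟪f, bergmanIncl g⟫_ℂ :=
  bergmanSubmodule.inner_orthogonalProjectionOnto_eq_of_mem_right g f

theorem bergmanProj_incl (f : Bergman) : bergmanProj (bergmanIncl f) = f :=
  bergmanSubmodule.orthogonalProjectionOnto_mem_subspace_eq_self f

/-- The holomorphic representative of an element of the Bergman space. -/
def holRep (f : Bergman) : ℂ → ℂ := f.2.choose

theorem holRep_differentiableOn (f : Bergman) :
    DifferentiableOn ℂ (holRep f) upperHalfPlaneSet := f.2.choose_spec.1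

theorem holRep_ae_eq (f : Bergman) : bergmanIncl f =ᵐ[areaMeasure] holRep f := f.2.choose_spec.2

theorem norm_holRep_le (f : Bergman) (z : ℍ) : ‖holRep f z‖ ≤ (z.im)⁻¹ * ‖f‖ := by
  have h := enorm_le_eLpNorm (holRep_differentiableOn f) (z := z) z.im_pos
  have hz : 0 ≤ (z : ℂ).im⁻¹ := inv_nonneg.2 z.im_pos.le
  rw [← eLpNorm_congr_ae (holRep_ae_eq f), ← Lp.enorm_def, ← ofReal_norm, ← ofReal_norm,
    ← ENNReal.ofReal_mul hz, ENNReal.ofReal_le_ofReal_iff (mul_nonneg hz (norm_nonneg _))] at h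
  exact h

/-- Point evaluation `f ↦ f(z)` on the Bergman space. -/
def bergmanEval (z : ℍ) : Bergman →L[ℂ] ℂ :=
  LinearMap.mkContinuous
    { toFun := fun f => holRep f z
      map_add' := fun f g => by
        refine eqOn_of_ae_eq_areaMeasure (holRep_differentiableOn _)
          ((holRep_differentiableOn f).add (holRep_differentiableOn g)) ?_ z.im_pos
        exact (holRep_ae_eq _).symm.trans
          ((Lp.coeFn_add _ _).trans ((holRep_ae_eq f).add (holRep_ae_eq g)))
      map_smul' := fun c f => by
        refine eqOn_of_ae_eq_areaMeasure (holRep_differentiableOn _)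
          ((holRep_differentiableOn f).const_smul c) ?_ z.im_pos
        exact (holRep_ae_eq _).symm.trans
          ((Lp.coeFn_smul _ _).trans ((holRep_ae_eq f).const_smul c)) }
    (z.im)⁻¹ (fun f => norm_holRep_le f z)

theorem eq_of_bergmanEval_eq {f g : Bergman} (h : ∀ z : ℍ, bergmanEval z f = bergmanEval z g) :
    f = g := by
  refine Subtype.ext (Lp.ext ?_)
  refine (holRep_ae_eq f).trans (Filter.EventuallyEq.trans ?_ (holRep_ae_eq g).symm)
  filter_upwards [ae_restrict_mem isOpen_upperHalfPlaneSet.measurableSet] with z hz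
  exact h ⟨z, hz⟩

/-- Multiplication by a bounded measurable symbol on `L²(Π)`. -/
def mulSymbol (a : Lp ℂ ∞ areaMeasure) : Lp ℂ 2 areaMeasure →L[ℂ] Lp ℂ 2 areaMeasure :=
  (ContinuousLinearMap.mul ℂ ℂ).holderL areaMeasure ∞ 2 2 a

/-- The Toeplitz operator `f ↦ B(af)` on the Bergman space. -/
def toeplitz (a : Lp ℂ ∞ areaMeasure) : Bergman →L[ℂ] Bergman :=
  bergmanProj ∘L mulSymbol a ∘L bergmanIncl

/-- The vertical symbol `z ↦ χ_s(Im z)`. -/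
def verticalSymbol (s : Set ℝ) (hs : MeasurableSet s) : Lp ℂ ∞ areaMeasure :=
  MemLp.toLp (fun z : ℂ => s.indicator (fun _ => (1 : ℂ)) z.im)
    (memLp_top_of_bound
      ((measurable_const.indicator hs).comp Complex.measurable_im).aestronglyMeasurable 1
      (Filter.Eventually.of_forall fun z => by
        by_cases h : z.im ∈ s <;> simp [h]))

theorem mulSymbol_verticalSymbol_ae (s : Set ℝ) (hs : MeasurableSet s) (f : Lp ℂ 2 areaMeasure) :
    mulSymbol (verticalSymbol s hs) f =ᵐ[areaMeasure]
      fun z => s.indicator (fun _ => (1 : ℂ)) z.im * f z := by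
  refine ((ContinuousLinearMap.mul ℂ ℂ).coeFn_holder (r := 2) (verticalSymbol s hs) f).trans ?_
  filter_upwards [MemLp.coeFn_toLp (memLp_top_of_bound
      ((measurable_const.indicator hs).comp Complex.measurable_im).aestronglyMeasurable 1
      (Filter.Eventually.of_forall fun z => by
        by_cases h : z.im ∈ s <;> simp [h]) :
      MemLp (fun z : ℂ => s.indicator (fun _ => (1 : ℂ)) z.im) ∞ areaMeasure)] with z hz
  rw [ContinuousLinearMap.mul_apply']
  congr 1

theorem toeplitz_nonneg (s : Set ℝ) (hs : MeasurableSet s) :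
    0 ≤ toeplitz (verticalSymbol s hs) := by
  rw [ContinuousLinearMap.nonneg_iff_isPositive, ContinuousLinearMap.isPositive_iff_complex]
  intro f
  have key : ⟪toeplitz (verticalSymbol s hs) f, f⟫_ℂ =
      ((∫ z, s.indicator (fun _ => (1 : ℝ)) z.im * ‖bergmanIncl f z‖ ^ 2 ∂areaMeasure : ℝ) : ℂ) := by
    rw [toeplitz, ContinuousLinearMap.comp_apply, inner_bergmanProj, L2.inner_def,
      ← integral_complex_ofReal]
    refine integral_congr_ae ?_
    filter_upwards [mulSymbol_verticalSymbol_ae s hs (bergmanIncl f)] with z hz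
    rw [ContinuousLinearMap.comp_apply, hz]
    by_cases h : z.im ∈ s
    · simp [h]
    · simp [h]
  rw [key]
  refine ⟨by simp, ?_⟩
  rw [RCLike.re_to_complex, Complex.ofReal_re]
  refine integral_nonneg fun z => mul_nonneg ?_ (by positivity)
  exact Set.indicator_nonneg (fun _ _ => zero_le_one) _

/-- The sets of heights supporting the symbols: `[j-1, j)` for `j = 1, …, n-1` and `[n-1, ∞)` for
`j = n`. The `j`-th component corresponds to the index `i = j-1` of `Fin n`. -/
def band (n : ℕ) (i : Fin n) : Set ℝ :=
  if (i : ℕ) + 1 = n then Set.Ici ((n : ℝ) - 1) else Set.Ico (i : ℝ) ((i : ℝ) + 1)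

theorem measurableSet_band (n : ℕ) (i : Fin n) : MeasurableSet (band n i) := by
  unfold band; split_ifs
  exacts [measurableSet_Ici, measurableSet_Ico]

/-- The Toeplitz operators `T_{a_j}`. -/
def bandToeplitz (n : ℕ) (i : Fin n) : Bergman →L[ℂ] Bergman :=
  toeplitz (verticalSymbol (band n i) (measurableSet_band n i))

theorem sum_indicator_band (n : ℕ) (hn : 0 < n) (y : ℝ) (hy : 0 ≤ y) :
    ∑ i, (band n i).indicator (fun _ => (1 : ℂ)) y = 1 := by
  have hfl := Nat.floor_le hy
  have hlt := Nat.lt_floor_add_one y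
  let i₀ : Fin n := ⟨min ⌊y⌋₊ (n - 1), by omega⟩
  have hmem : ∀ i : Fin n, y ∈ band n i ↔ i = i₀ := by
    intro i
    have hi := i.2
    unfold band
    rw [Fin.ext_iff]
    simp only [i₀]
    split_ifs with h
    · rw [Set.mem_Ici, ← Nat.cast_pred hn, ← Nat.le_floor_iff hy]
      omega
    · rw [Set.mem_Ico, ← Nat.le_floor_iff hy, ← Nat.cast_add_one, ← Nat.floor_lt hy]
      omega
  rw [Finset.sum_eq_single i₀]
  · rw [Set.indicator_of_mem ((hmem i₀).2 rfl)]
  · intro i _ hi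
    exact Set.indicator_of_notMem (fun h => hi ((hmem i).1 h)) _
  · simp

theorem sum_bandToeplitz (n : ℕ) (hn : 0 < n) : ∑ i, bandToeplitz n i = 1 := by
  ext1 f
  have h : ∑ i, mulSymbol (verticalSymbol (band n i) (measurableSet_band n i)) (bergmanIncl f) =
      bergmanIncl f := by
    refine Lp.ext ((Lp.coeFn_fun_finsetSum _ _).trans ?_)
    filter_upwards [ae_all_iff.2 fun i =>
      mulSymbol_verticalSymbol_ae (band n i) (measurableSet_band n i) (bergmanIncl f),
      ae_restrict_mem isOpen_upperHalfPlaneSet.measurableSet] with z hz hz0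
    simp only [hz]
    rw [← Finset.sum_mul, sum_indicator_band n hn z.im (le_of_lt hz0), one_mul]
  have h2 := congrArg bergmanProj h
  rw [map_sum, bergmanProj_incl] at h2
  rw [sum_apply]
  exact h2

/-- The Hilbert space `(A²(Π))ⁿ`. -/
abbrev BergmanPow (n : ℕ) : Type := PiLp 2 fun _ : Fin n => Bergman

/-- The operator `P_T` with matrix entries `√T_{a_j} √T_{a_k}`. -/
def projPT (n : ℕ) : BergmanPow n →L[ℂ] BergmanPow n :=
  (PiLp.continuousLinearEquiv 2 ℂ fun _ : Fin n => Bergman).symm.toContinuousLinearMap ∘L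
    ContinuousLinearMap.pi fun j => ∑ k,
      (CFC.sqrt (bandToeplitz n j) * CFC.sqrt (bandToeplitz n k)) ∘L
        PiLp.proj 2 (fun _ : Fin n => Bergman) k

theorem projPT_apply (n : ℕ) (f : BergmanPow n) (j : Fin n) :
    projPT n f j = ∑ k, CFC.sqrt (bandToeplitz n j) (CFC.sqrt (bandToeplitz n k) (f k)) := by
  simp [projPT]

theorem projPT_isIdempotentElem (n : ℕ) : IsIdempotentElem (projPT n) := by
  have hsq : ∀ (k : Fin n) (g : Bergman), CFC.sqrt (bandToeplitz n k)
      (CFC.sqrt (bandToeplitz n k) g) = bandToeplitz n k g := fun k g => by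
    have h : 0 ≤ bandToeplitz n k := toeplitz_nonneg _ _
    rw [← mul_apply_eq_comp, CFC.sqrt_mul_sqrt_self _ h]
  refine ContinuousLinearMap.ext fun f => PiLp.ext fun j => ?_
  have hn : 0 < n := j.pos
  rw [mul_apply_eq_comp, projPT_apply, projPT_apply]
  rw [← map_sum, ← map_sum]
  congr 1
  have : ∀ k, CFC.sqrt (bandToeplitz n k) (projPT n f k) =
      bandToeplitz n k (∑ l, CFC.sqrt (bandToeplitz n l) (f l)) := fun k => by
    rw [projPT_apply, ← map_sum, hsq]
  simp only [this]
  rw [← sum_apply, sum_bandToeplitz n hn, one_apply_eq_self]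

/-- The image of `P_T`, a Hilbert space with the inner product of `(A²(Π))ⁿ`. -/
abbrev imagePT (n : ℕ) : Submodule ℂ (BergmanPow n) := (projPT n).range

instance (n : ℕ) : CompleteSpace (imagePT n) :=
  (ContinuousLinearMap.IsIdempotentElem.isClosed_range
    (projPT_isIdempotentElem n)).completeSpace_coe

/-- The image of `P_T` as a Hilbert space of functions `Π → ℂⁿ`, through the values of the
holomorphic components. -/
instance (n : ℕ) : RKHS ℂ (imagePT n) ℍ (EuclideanSpace ℂ (Fin n)) where
  coeCLM := ContinuousLinearMap.pi fun z =>
    (PiLp.continuousLinearEquiv 2 ℂ fun _ : Fin n => ℂ).symm.toContinuousLinearMap ∘L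
      (ContinuousLinearMap.pi fun j => bergmanEval z ∘L
        PiLp.proj 2 (fun _ : Fin n => Bergman) j) ∘L (imagePT n).subtypeL
  coeCLM_injective := by
    intro f g h
    refine Subtype.ext (PiLp.ext fun j => eq_of_bergmanEval_eq fun z => ?_)
    have := congrArg (fun v : EuclideanSpace ℂ (Fin n) => v j) (congrFun h z)
    simpa using this

/-- The `n × n` matrix of the reproducing kernel `K(z, w)` of the image of `P_T`; its `k`-th
column is `K(z, w) e_k`. -/
def kernelPT (n : ℕ) (z w : ℍ) : Matrix (Fin n) (Fin n) ℂ :=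
  Matrix.of fun j k => (RKHS.kernel (imagePT n) z w (EuclideanSpace.single k (1 : ℂ))) j

/-- The functions `G_m(z, w) = -1 / (π (z - w̄ + m i)²)`. -/
def kernelG (m : ℤ) (z w : ℂ) : ℂ := -1 / (Real.pi * (z - conj w + m * Complex.I) ^ 2)

/-- Nielsen's beta function `β(z) = ∫₀^∞ e^{-zt} / (1 + e^{-t}) dt`, for `Re z > 0`. -/
def nielsenBeta (z : ℂ) : ℂ :=
  ∫ t in Set.Ioi (0 : ℝ), Complex.exp (-z * t) / (1 + Complex.exp (-t))

/-- The harmonic function `H(z) = ψ(z + 1) + γ`. -/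
def harmonicFn (z : ℂ) : ℂ := Complex.digamma (z + 1) + Real.eulerMascheroniConstant

/-- `J(p) = ∫₀^∞ e^{-pt} (1 - e^{-2t})^{1/2} dt`, for `Re p > 0`. -/
def laplaceJ (p : ℂ) : ℂ :=
  ∫ t in Set.Ioi (0 : ℝ), Complex.exp (-p * t) * (Real.sqrt (1 - Real.exp (-2 * t)) : ℂ)

end

/-! Everything reduces to functions of one positive contraction. The Bergman kernel depends on `z`
and `w` only through `z - conj w`, so restricting an integral against it to `Im z ≥ s` and
substituting `z + s i` moves the kernel's base point to `w + s i`. The reproducing property then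
shows that the Toeplitz operator of `χ_{[s,∞)}(Im z)` is the translation `f ↦ f(· + 2 s i)`
(`bergmanEval_toeplitz_Ici`). With `S = shiftOp`, the translation by `i`, the operators `T_{a_j}`
are `S^(2(j-1)) - S^(2j)` for `j < n` and `S^(2(n-1))` for `j = n`. Since `0 ≤ S ≤ 1`, their square
roots are `x^(j-1) √(1-x²)` and `x^(n-1)` evaluated at `S`.

The operator `P_T` is self-adjoint and fixes its image, so `K_{jk}(·, w)` is `√T_{a_j} √T_{a_k}`
applied to the Bergman kernel at `w` (`kernelPT_eq`). Writing that kernel as a Laplace integral with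
density `t e^{-at} / π`, `a = -i(z - conj w)`, turns `S` into multiplication by `e^{-t}`. By
Weierstrass approximation the same holds for every continuous function of `S`
(`bergmanEval_cfc_shiftOp`).

When `j, k < n` the two square roots multiply to a polynomial, and when `j = k = n` there are none;
both cases give functions `G_m`. In the mixed case one root survives and the entry is `-J'(p)/π`.
The substitution `x = e^{-2t}` makes `J` a beta integral, so its logarithmic derivative is a digamma
difference, which is matched with `β` by uniqueness of decaying solutions of `f(p) + f(p+1) = 1/p`.
-/

/-! ### Laplace transforms and the Gamma formula for `J`. -/

theorem integrableOn_mul_exp_neg {c : ℝ} (hc : 0 < c) :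
    IntegrableOn (fun t : ℝ => t * Real.exp (-c * t)) (Set.Ioi 0) := by
  have h := integrableOn_rpow_mul_exp_neg_mul_rpow (s := 1) (p := 1) (b := c) (by norm_num)
    (by norm_num) hc
  simpa using h

theorem norm_cexp_neg_mul (p : ℂ) (t : ℝ) :
    ‖Complex.exp (-p * t)‖ = Real.exp (-p.re * t) := by
  rw [Complex.norm_exp]; simp

theorem integrableOn_cexp_neg_mul {g : ℝ → ℂ} (hg : Measurable g)
    (hb : ∀ t, 0 < t → ‖g t‖ ≤ 1) {p : ℂ} (hp : 0 < p.re) :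
    IntegrableOn (fun t : ℝ => Complex.exp (-p * t) * g t) (Set.Ioi 0) := by
  refine (integrableOn_exp_mul_Ioi (a := -p.re) (by linarith) 0).mono' ?_ ?_
  · exact (Measurable.mul (by fun_prop) hg).aestronglyMeasurable
  · filter_upwards [ae_restrict_mem measurableSet_Ioi] with t ht
    rw [norm_mul, norm_cexp_neg_mul]
    exact mul_le_of_le_one_right (Real.exp_pos _).le (hb t ht)

/-- A Laplace transform may be differentiated under the integral sign. -/
theorem hasDerivAt_laplace {g : ℝ → ℂ} (hg : Measurable g)
    (hb : ∀ t, 0 < t → ‖g t‖ ≤ 1) {p : ℂ} (hp : 0 < p.re) :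
    HasDerivAt (fun q : ℂ => ∫ t in Set.Ioi (0 : ℝ), Complex.exp (-q * t) * g t)
      (-∫ t in Set.Ioi (0 : ℝ), (t : ℂ) * Complex.exp (-p * t) * g t) p := by
  rw [← integral_neg]
  -- Keeping `Re q` above `Re p / 2` gives one integrable majorant `t e^{-(Re p / 2) t}` for all
  -- nearby derivatives.
  have hopen : {q : ℂ | p.re / 2 < q.re} ∈ nhds p :=
    (isOpen_lt continuous_const Complex.continuous_re).mem_nhds (by simpa using hp)
  refine (hasDerivAt_integral_of_dominated_loc_of_deriv_le (𝕜 := ℂ)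
    (μ := volume.restrict (Set.Ioi (0 : ℝ)))
    (F := fun (q : ℂ) (t : ℝ) => Complex.exp (-q * t) * g t)
    (F' := fun (q : ℂ) (t : ℝ) => -((t : ℂ) * Complex.exp (-q * t) * g t))
    (bound := fun t => t * Real.exp (-(p.re / 2) * t)) hopen ?_
    (integrableOn_cexp_neg_mul hg hb hp) ?_ ?_ (integrableOn_mul_exp_neg (by positivity)) ?_).2
  · exact Filter.Eventually.of_forall fun q =>
      (Measurable.mul (by fun_prop) hg).aestronglyMeasurable
  · exact (Measurable.mul (by fun_prop) hg).neg.aestronglyMeasurable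
  · filter_upwards [ae_restrict_mem measurableSet_Ioi] with t ht q hq
    have ht : 0 < t := ht
    have hq : p.re / 2 < q.re := hq
    rw [norm_neg, norm_mul, norm_mul, norm_cexp_neg_mul, Complex.norm_real,
      Real.norm_of_nonneg ht.le]
    refine (mul_le_of_le_one_right (by positivity) (hb t ht)).trans ?_
    gcongr
  · refine Filter.Eventually.of_forall fun t q _ => ?_
    have h : HasDerivAt (fun q : ℂ => -q * t) (-1 * t) q := (hasDerivAt_id q).neg.mul_const _
    convert! h.cexp.mul_const (g t) using 1
    ring

theorem integral_cexp_neg {p : ℂ} (hp : 0 < p.re) :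
    ∫ t in Set.Ioi (0 : ℝ), Complex.exp (-p * t) = 1 / p := by
  rw [integral_exp_mul_complex_Ioi (by simpa using hp)]
  simp

/-- Both sides are minus the derivative of `∫ e^{-pt} dt = 1/p`. -/
theorem integral_mul_cexp_neg {p : ℂ} (hp : 0 < p.re) :
    ∫ t in Set.Ioi (0 : ℝ), (t : ℂ) * Complex.exp (-p * t) = 1 / p ^ 2 := by
  have h1 := hasDerivAt_laplace (g := fun _ => 1) measurable_const (by simp) hp
  simp only [mul_one] at h1
  have hopen : {q : ℂ | 0 < q.re} ∈ nhds p :=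
    (isOpen_lt continuous_const Complex.continuous_re).mem_nhds hp
  have hp0 : p ≠ 0 := fun h => by simp [h] at hp
  have h2 := (hasDerivAt_inv hp0).congr_of_eventuallyEq
    (Filter.eventually_of_mem hopen fun q hq => (integral_cexp_neg hq).trans (one_div q))
  rw [neg_eq_iff_eq_neg.1 (h1.unique h2), neg_neg, one_div]

theorem norm_sqrt_one_sub_exp_le (t : ℝ) (_ : 0 < t) :
    ‖(Real.sqrt (1 - Real.exp (-2 * t)) : ℂ)‖ ≤ 1 := by
  rw [Complex.norm_real, Real.norm_of_nonneg (Real.sqrt_nonneg _)]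
  exact Real.sqrt_le_one.2 (by linarith [Real.exp_pos (-2 * t)])

theorem measurable_sqrt_one_sub_exp :
    Measurable fun t : ℝ => (Real.sqrt (1 - Real.exp (-2 * t)) : ℂ) := by fun_prop

/-- The substitution `x = e^{-2t}` turns the beta integral `B(p/2, 3/2)` into `2 J(p)`; Euler's
formula and `Γ(3/2) = √π / 2` give the rest. -/
theorem laplaceJ_eq_Gamma {p : ℂ} (hp : 0 < p.re) :
    laplaceJ p =
      (Real.sqrt Real.pi : ℂ) / 4 * (Complex.Gamma (p / 2) / Complex.Gamma (p / 2 + 3 / 2)) := by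
  have hp2 : 0 < (p / 2).re := by simpa using hp
  have hbeta := Complex.Gamma_mul_Gamma_eq_betaIntegral hp2
    (show 0 < (3 / 2 : ℂ).re by norm_num)
  have hG : Complex.Gamma (3 / 2) = (Real.sqrt Real.pi : ℂ) / 2 := by
    rw [show (3 / 2 : ℂ) = 1 / 2 + 1 by norm_num, Complex.Gamma_add_one _ (by norm_num),
      Complex.Gamma_one_half_eq, Real.sqrt_eq_rpow, Complex.ofReal_cpow Real.pi_pos.le]
    push_cast
    ring
  have hne : Complex.Gamma (p / 2 + 3 / 2) ≠ 0 :=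
    Complex.Gamma_ne_zero_of_re_pos (by rw [Complex.add_re]; norm_num; linarith)
  have himg : (fun t : ℝ => Real.exp (-2 * t)) '' Set.Ioi 0 = Set.Ioo 0 1 := by
    ext x
    constructor
    · rintro ⟨t, ht, rfl⟩
      have ht : 0 < t := ht
      exact ⟨Real.exp_pos _, by rw [Real.exp_lt_one_iff]; linarith⟩
    · rintro ⟨h0, h1⟩
      refine ⟨-Real.log x / 2, ?_, ?_⟩
      · have := Real.log_neg h0 h1
        rw [Set.mem_Ioi]
        linarith
      · simp only
        rw [show -2 * (-Real.log x / 2) = Real.log x by ring, Real.exp_log h0]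
  have key : Complex.betaIntegral (p / 2) (3 / 2) = 2 * laplaceJ p := by
    rw [Complex.betaIntegral, intervalIntegral.integral_of_le zero_le_one,
      integral_Ioc_eq_integral_Ioo, ← himg, integral_image_eq_integral_abs_deriv_smul
      (f' := fun t => -2 * Real.exp (-2 * t)) measurableSet_Ioi, laplaceJ, ← integral_const_mul]
    · refine setIntegral_congr_fun measurableSet_Ioi fun t ht => ?_
      have ht : 0 < t := ht
      have h1 : 0 ≤ 1 - Real.exp (-2 * t) := by
        have := Real.exp_le_one_iff.2 (show -2 * t ≤ 0 by linarith)
        linarith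
      rw [show (3 / 2 : ℂ) - 1 = ((1 / 2 : ℝ) : ℂ) by push_cast; norm_num,
        ← Complex.ofReal_one, ← Complex.ofReal_sub, ← Complex.ofReal_cpow h1,
        ← Real.sqrt_eq_rpow, abs_mul, abs_neg, abs_two, abs_of_pos (Real.exp_pos _),
        Complex.ofReal_exp, Complex.cpow_def_of_ne_zero (Complex.exp_ne_zero _),
        ← Complex.ofReal_exp, ← Complex.ofReal_log (Real.exp_pos _).le, Real.log_exp,
        Complex.real_smul]
      push_cast
      -- The first exponential is the Jacobian factor, the second is `x^(p/2 - 1)`.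
      rw [show -p * (t : ℂ) = -2 * (t : ℂ) + -2 * (t : ℂ) * (p / 2 - 1) by ring, Complex.exp_add]
      ring
    · intro t _
      have h : HasDerivAt (fun t : ℝ => -2 * t) (-2 * 1) t := (hasDerivAt_id t).const_mul _
      convert! h.exp.hasDerivWithinAt using 1
      ring
    · intro s _ t _ h
      have := Real.exp_injective h
      linarith
  rw [hG, key] at hbeta
  rw [← mul_div_assoc, eq_div_iff hne]
  linear_combination -hbeta / 2

theorem hasDerivAt_laplaceJ {p : ℂ} (hp : 0 < p.re) :
    HasDerivAt laplaceJ (-∫ t in Set.Ioi (0 : ℝ), (t : ℂ) * Complex.exp (-p * t) *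
      (Real.sqrt (1 - Real.exp (-2 * t)) : ℂ)) p :=
  hasDerivAt_laplace measurable_sqrt_one_sub_exp norm_sqrt_one_sub_exp_le hp

theorem ne_neg_natCast_of_re_pos {p : ℂ} (hp : 0 < p.re) (m : ℕ) : p ≠ -m := by
  rintro rfl
  simp only [Complex.neg_re, Complex.natCast_re] at hp
  have : (0 : ℝ) ≤ m := by positivity
  linarith

theorem hasDerivAt_Gamma_digamma {p : ℂ} (hp : 0 < p.re) :
    HasDerivAt Complex.Gamma (Complex.Gamma p * Complex.digamma p) p := by
  have h := (Complex.differentiableAt_Gamma p (ne_neg_natCast_of_re_pos hp)).hasDerivAt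
  rwa [Complex.digamma_def, logDeriv_apply, mul_div_cancel₀ _ (Complex.Gamma_ne_zero_of_re_pos hp)]

/-- The integral is `-J'(p)`; the right side is the same derivative computed from the Gamma quotient
by logarithmic differentiation. -/
theorem integral_mul_sqrt_eq_digamma {p : ℂ} (hp : 0 < p.re) :
    ∫ t in Set.Ioi (0 : ℝ), (t : ℂ) * Complex.exp (-p * t) *
      (Real.sqrt (1 - Real.exp (-2 * t)) : ℂ) =
    laplaceJ p * ((Complex.digamma (p / 2 + 3 / 2) - Complex.digamma (p / 2)) / 2) := by
  have hp2 : 0 < (p / 2).re := by simpa using hp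
  have hp3 : 0 < (p / 2 + 3 / 2).re := by rw [Complex.add_re]; norm_num; linarith
  have hne := Complex.Gamma_ne_zero_of_re_pos hp3
  have hd2 : HasDerivAt (fun q : ℂ => q / 2) (1 / 2) p := (hasDerivAt_id p).div_const 2
  have h1 := (hasDerivAt_Gamma_digamma hp2).comp p hd2
  have h2 := (hasDerivAt_Gamma_digamma hp3).comp p (hd2.add_const (3 / 2))
  have h3 := (h1.div h2 hne).const_mul ((Real.sqrt Real.pi : ℂ) / 4)
  have hopen : {q : ℂ | 0 < q.re} ∈ nhds p :=
    (isOpen_lt continuous_const Complex.continuous_re).mem_nhds hp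
  have h4 := h3.congr_of_eventuallyEq (f₁ := laplaceJ)
    (Filter.eventually_of_mem hopen fun q hq => laplaceJ_eq_Gamma hq)
  have h5 := (hasDerivAt_laplaceJ hp).unique h4
  rw [neg_eq_iff_eq_neg] at h5
  rw [h5, laplaceJ_eq_Gamma hp]
  simp only [Function.comp_apply]
  field_simp
  ring

/-! ### Nielsen's beta function as a digamma difference. -/

/-- Half the increment of the digamma function over a step of length `1 / 2`. -/
noncomputable def digammaHalfDiff (p : ℂ) : ℂ :=
  (Complex.digamma ((p + 1) / 2) - Complex.digamma (p / 2)) / 2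

theorem differentiableAt_digamma {p : ℂ} (hp : 0 < p.re) :
    DifferentiableAt ℂ Complex.digamma p := by
  have hopen : IsOpen {q : ℂ | 0 < q.re} := isOpen_lt continuous_const Complex.continuous_re
  have hd : DifferentiableOn ℂ Complex.Gamma {q : ℂ | 0 < q.re} := fun q hq =>
    (hasDerivAt_Gamma_digamma hq).differentiableAt.differentiableWithinAt
  have h1 := (hd.deriv hopen).differentiableAt (hopen.mem_nhds hp)
  exact h1.div (hasDerivAt_Gamma_digamma hp).differentiableAt (Complex.Gamma_ne_zero_of_re_pos hp)

theorem differentiableOn_digammaHalfDiff :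
    DifferentiableOn ℂ digammaHalfDiff {q : ℂ | 0 < q.re} := by
  intro p hp
  have hp : 0 < p.re := hp
  have h1 : DifferentiableAt ℂ (fun q : ℂ => Complex.digamma ((q + 1) / 2)) p :=
    DifferentiableAt.comp (g := Complex.digamma) p
      (differentiableAt_digamma (by simp; linarith)) (by fun_prop)
  have h2 : DifferentiableAt ℂ (fun q : ℂ => Complex.digamma (q / 2)) p :=
    DifferentiableAt.comp (g := Complex.digamma) p
      (differentiableAt_digamma (by simpa using hp)) (by fun_prop)
  exact ((h1.sub h2).div_const 2).differentiableWithinAt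

/-- The sum of two consecutive half steps telescopes to `ψ(p/2 + 1) - ψ(p/2) = 2/p`. -/
theorem digammaHalfDiff_add_one {p : ℂ} (hp : 0 < p.re) :
    digammaHalfDiff p + digammaHalfDiff (p + 1) = 1 / p := by
  have h := Complex.digamma_apply_add_one (p / 2)
    (ne_neg_natCast_of_re_pos (by simpa using hp))
  have hp0 : p ≠ 0 := fun h => by simp [h] at hp
  unfold digammaHalfDiff
  rw [show (p + 1 + 1) / 2 = p / 2 + 1 by ring, h]
  field_simp
  ring

theorem measurable_one_div_one_add_cexp :
    Measurable fun t : ℝ => 1 / (1 + Complex.exp (-(t : ℂ))) := by fun_prop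

theorem one_add_cexp_eq (t : ℝ) :
    1 + Complex.exp (-(t : ℂ)) = ((1 + Real.exp (-t) : ℝ) : ℂ) := by push_cast; rfl

theorem norm_one_div_one_add_cexp_le (t : ℝ) (_ : 0 < t) :
    ‖1 / (1 + Complex.exp (-(t : ℂ)))‖ ≤ 1 := by
  rw [one_add_cexp_eq, norm_div, norm_one, Complex.norm_real,
    Real.norm_of_nonneg (by positivity)]
  exact (div_le_one (by positivity)).2 (by linarith [Real.exp_pos (-t)])

theorem nielsenBeta_eq (p : ℂ) : nielsenBeta p = ∫ t in Set.Ioi (0 : ℝ),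
    Complex.exp (-p * t) * (1 / (1 + Complex.exp (-(t : ℂ)))) := by
  simp only [nielsenBeta, mul_one_div]

theorem differentiableOn_nielsenBeta :
    DifferentiableOn ℂ nielsenBeta {q : ℂ | 0 < q.re} := by
  intro p hp
  rw [funext nielsenBeta_eq]
  exact (hasDerivAt_laplace measurable_one_div_one_add_cexp norm_one_div_one_add_cexp_le
    hp).differentiableAt.differentiableWithinAt

/-- Adding the integrands produces the factor `1 + e^{-t}`, which cancels the denominator and leaves
`∫ e^{-pt} dt`. -/
theorem nielsenBeta_add_one {p : ℂ} (hp : 0 < p.re) :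
    nielsenBeta p + nielsenBeta (p + 1) = 1 / p := by
  have hp1 : 0 < (p + 1).re := by simp; linarith
  have hi := fun q hq => integrableOn_cexp_neg_mul (p := q) measurable_one_div_one_add_cexp
    norm_one_div_one_add_cexp_le hq
  rw [nielsenBeta_eq, nielsenBeta_eq, ← integral_add (hi p hp) (hi _ hp1),
    ← integral_cexp_neg hp]
  refine integral_congr_ae (Filter.Eventually.of_forall fun t => ?_)
  have hne : 1 + Complex.exp (-(t : ℂ)) ≠ 0 := by
    rw [one_add_cexp_eq]
    exact_mod_cast (show (0 : ℝ) < 1 + Real.exp (-t) by positivity).ne'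
  simp only
  rw [show -(p + 1) * (t : ℂ) = -p * t + -t by ring, Complex.exp_add]
  field_simp

theorem norm_nielsenBeta_le {p : ℂ} (hp : 0 < p.re) : ‖nielsenBeta p‖ ≤ 1 / p.re := by
  rw [nielsenBeta_eq]
  refine (norm_integral_le_integral_norm _).trans ?_
  have h : ∫ t in Set.Ioi (0 : ℝ), Real.exp (-p.re * t) = 1 / p.re := by
    rw [integral_exp_mul_Ioi (by linarith)]
    simp
  rw [← h]
  refine setIntegral_mono_on (integrableOn_cexp_neg_mul measurable_one_div_one_add_cexp
    norm_one_div_one_add_cexp_le hp).norm (integrableOn_exp_mul_Ioi (by linarith) 0)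
    measurableSet_Ioi fun t ht => ?_
  rw [norm_mul, norm_cexp_neg_mul]
  exact mul_le_of_le_one_right (Real.exp_pos _).le (norm_one_div_one_add_cexp_le t ht)

/-- This form makes the convexity of `log Γ` available as monotonicity of the digamma function. -/
theorem digamma_ofReal {x : ℝ} (hx : 0 < x) :
    Complex.digamma x = ((deriv (Real.log ∘ Real.Gamma) x : ℝ) : ℂ) := by
  have hd := Real.differentiableAt_Gamma (s := x) (fun m => by
    have : (0 : ℝ) ≤ m := by positivity
    linarith)
  have h1 := (hasDerivAt_Gamma_digamma (p := x) (by simpa using hx)).comp_ofReal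
  simp only [Complex.Gamma_ofReal] at h1
  have h2 := h1.unique hd.hasDerivAt.ofReal_comp
  have hG := (Real.Gamma_pos_of_pos hx).ne'
  rw [Real.deriv_log_comp_eq_logDeriv hd hG, logDeriv_apply]
  push_cast
  rw [← h2, mul_div_cancel_left₀]
  exact_mod_cast hG

/-- Log-convexity of `Γ` makes `ψ` increasing on the positive axis, so `ψ((x+1)/2)` lies between
`ψ(x/2)` and `ψ(x/2 + 1) = ψ(x/2) + 2/x`. -/
theorem norm_digammaHalfDiff_le {x : ℝ} (hx : 0 < x) : ‖digammaHalfDiff x‖ ≤ 1 / x := by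
  have hd : DifferentiableOn ℝ (Real.log ∘ Real.Gamma) (Set.Ioi 0) := fun y hy => by
    have hy : 0 < y := hy
    exact ((Real.differentiableAt_Gamma (fun m => by
      have : (0 : ℝ) ≤ m := by positivity
      linarith)).log (Real.Gamma_pos_of_pos hy).ne').differentiableWithinAt
  have hmono : MonotoneOn (deriv (Real.log ∘ Real.Gamma)) (Set.Ioi 0) :=
    Real.convexOn_log_Gamma.monotoneOn_deriv fun y hy =>
      hd.differentiableAt (Ioi_mem_nhds hy)
  have h0 : (0 : ℝ) < x / 2 := by positivity
  have h1 : (0 : ℝ) < (x + 1) / 2 := by positivity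
  have h2 : (0 : ℝ) < x / 2 + 1 := by positivity
  have e0 : digammaHalfDiff x = (((deriv (Real.log ∘ Real.Gamma) ((x + 1) / 2) -
      deriv (Real.log ∘ Real.Gamma) (x / 2)) / 2 : ℝ) : ℂ) := by
    push_cast
    rw [← digamma_ofReal h0, ← digamma_ofReal h1, digammaHalfDiff]
    push_cast
    rfl
  have e1 : deriv (Real.log ∘ Real.Gamma) (x / 2 + 1) =
      deriv (Real.log ∘ Real.Gamma) (x / 2) + (x / 2)⁻¹ := by
    have h := Complex.digamma_apply_add_one ((x / 2 : ℝ) : ℂ)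
      (ne_neg_natCast_of_re_pos (by simpa using hx))
    rw [← Complex.ofReal_one, ← Complex.ofReal_add, digamma_ofReal h0, digamma_ofReal h2] at h
    exact_mod_cast h
  have m1 := hmono h0 h1 (by linarith)
  have m2 := hmono h1 h2 (by linarith)
  rw [e0, Complex.norm_real, Real.norm_of_nonneg (by linarith)]
  have : (x / 2)⁻¹ = 2 * (1 / x) := by field_simp
  linarith

/-- Both functions solve `f(p) + f(p+1) = 1/p`, so their difference only changes sign under `p ↦ p +
1`. Its modulus at `x` therefore equals that at `x + k`, which is at most `2/(x + k)` and tends to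
`0`. -/
theorem nielsenBeta_ofReal_eq {x : ℝ} (hx : 0 < x) :
    nielsenBeta x = digammaHalfDiff x := by
  have hstep : ∀ k : ℕ, ‖nielsenBeta x - digammaHalfDiff x‖ =
      ‖nielsenBeta ((x + k : ℝ) : ℂ) - digammaHalfDiff ((x + k : ℝ) : ℂ)‖ := by
    intro k
    induction k with
    | zero => simp
    | succ k ih =>
      have hp : 0 < ((x + k : ℝ) : ℂ).re := by rw [Complex.ofReal_re]; positivity
      have e1 := nielsenBeta_add_one hp
      have e2 := digammaHalfDiff_add_one hp
      rw [ih, show ((x + (k + 1 : ℕ) : ℝ) : ℂ) = ((x + k : ℝ) : ℂ) + 1 by push_cast; ring,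
        ← norm_neg]
      congr 1
      linear_combination e2 - e1
  have hbound : ∀ k : ℕ, ‖nielsenBeta x - digammaHalfDiff x‖ ≤ 2 * (1 / (x + k)) := by
    intro k
    have hpos : 0 < x + k := by positivity
    rw [hstep k, two_mul]
    have hb := norm_nielsenBeta_le (p := ((x + k : ℝ) : ℂ)) (by simpa using hpos)
    rw [Complex.ofReal_re] at hb
    exact (norm_sub_le _ _).trans (add_le_add hb (norm_digammaHalfDiff_le hpos))
  have hlim : Filter.Tendsto (fun k : ℕ => 2 * (1 / (x + k))) Filter.atTop (nhds 0) := by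
    have h := (Filter.tendsto_atTop_add_const_left Filter.atTop x
      tendsto_natCast_atTop_atTop).inv_tendsto_atTop.const_mul (2 : ℝ)
    simpa using h
  rw [← sub_eq_zero, ← norm_le_zero_iff]
  exact ge_of_tendsto' hlim hbound

theorem nielsenBeta_eq_digammaHalfDiff {p : ℂ} (hp : 0 < p.re) :
    nielsenBeta p = digammaHalfDiff p := by
  have hopen : IsOpen {q : ℂ | 0 < q.re} := isOpen_lt continuous_const Complex.continuous_re
  have hconn : IsPreconnected {q : ℂ | 0 < q.re} :=
    (convex_halfSpace_re_gt 0).isPreconnected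
  refine (differentiableOn_nielsenBeta.analyticOnNhd hopen).eqOn_of_preconnected_of_frequently_eq
    (differentiableOn_digammaHalfDiff.analyticOnNhd hopen) hconn
    (z₀ := 1) (by simp) ?_ hp
  -- The identity theorem needs agreement on points accumulating at `1` but different from it; these
  -- real points provide it.
  have ht : Filter.Tendsto (fun k : ℕ => ((1 + 1 / ((k : ℝ) + 1) : ℝ) : ℂ)) Filter.atTop
      (nhdsWithin 1 {1}ᶜ) := by
    refine tendsto_nhdsWithin_iff.2 ⟨?_, Filter.Eventually.of_forall fun k => ?_⟩
    · have h := (tendsto_one_div_add_atTop_nhds_zero_nat (𝕜 := ℝ)).const_add 1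
      rw [add_zero] at h
      exact (Complex.continuous_ofReal.tendsto 1).comp h
    · have : (0 : ℝ) < 1 / ((k : ℝ) + 1) := by positivity
      rw [Set.mem_compl_singleton_iff, ← Complex.ofReal_one, Ne, Complex.ofReal_inj]
      linarith
  exact ht.frequently (Filter.Frequently.of_forall fun k => nielsenBeta_ofReal_eq (by positivity))

theorem digamma_sub_eq_nielsenBeta {p : ℂ} (hp : 0 < p.re) :
    (Complex.digamma (p / 2 + 3 / 2) - Complex.digamma (p / 2)) / 2 =
      nielsenBeta p + 1 / (p + 1) := by
  have hp1 : 0 < ((p + 1) / 2).re := by simp; linarith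
  have h := Complex.digamma_apply_add_one ((p + 1) / 2) (ne_neg_natCast_of_re_pos hp1)
  have hne : p + 1 ≠ 0 := fun h => by rw [h] at hp1; simp at hp1
  rw [nielsenBeta_eq_digammaHalfDiff hp, digammaHalfDiff,
    show p / 2 + 3 / 2 = (p + 1) / 2 + 1 by ring, h]
  field_simp
  ring

/-- The constants `γ` cancel, and `2/p` compensates for the unit shift of the argument inside
`H(p/2)`. -/
theorem digamma_sub_eq_harmonicFn {p : ℂ} (hp : 0 < p.re) :
    Complex.digamma (p / 2 + 3 / 2) - Complex.digamma (p / 2) =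
      harmonicFn ((p + 1) / 2) - harmonicFn (p / 2) + 2 / p := by
  have h := Complex.digamma_apply_add_one (p / 2)
    (ne_neg_natCast_of_re_pos (by simpa using hp))
  rw [harmonicFn, harmonicFn, show (p + 1) / 2 + 1 = p / 2 + 3 / 2 by ring, h, inv_div]
  ring

/-! ### Area mean value on the disc and the Cayley transform. -/

theorem integral_circleMap_eq {g : ℂ → ℂ} {c : ℂ} {r : ℝ} (hr : 0 < r)
    (hg : DifferentiableOn ℂ g (Metric.closedBall c r)) :
    ∫ θ in Set.Ioo (-Real.pi) Real.pi, g (circleMap c r θ) = (2 * Real.pi : ℝ) • g c := by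
  have h1 : Real.circleAverage g c r = g c := by
    apply DiffContOnCl.circleAverage
    rw [abs_of_pos hr]
    apply DifferentiableOn.diffContOnCl
    rwa [closure_ball _ hr.ne']
  have hper : Function.Periodic (fun θ => g (circleMap c r θ)) (2 * Real.pi) := fun θ => by
    simp [periodic_circleMap c r θ]
  have h2 := hper.intervalIntegral_add_eq (-Real.pi) 0
  rw [zero_add, show -Real.pi + 2 * Real.pi = Real.pi by ring,
    intervalIntegral.integral_of_le (by linarith [Real.pi_pos]),
    integral_Ioc_eq_integral_Ioo] at h2
  rw [h2, ← h1, Real.circleAverage_def, smul_smul, mul_inv_cancel₀ (by positivity), one_smul]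

/-- The area mean value property of an integrable holomorphic function on the unit disc. -/
theorem integral_unitBall_eq {g : ℂ → ℂ} (hg : DifferentiableOn ℂ g (Metric.ball 0 1))
    (hi : IntegrableOn g (Metric.ball 0 1)) :
    ∫ z in Metric.ball (0 : ℂ) 1, g z = Real.pi * g 0 := by
  classical
  set f : ℂ → ℂ := (Metric.ball 0 1).indicator g with hf
  have hfm : Measurable f := by
    rw [hf, ← Set.piecewise_eq_indicator]
    exact hg.continuousOn.measurable_piecewise continuousOn_const
      Metric.isOpen_ball.measurableSet
  have hfi : Integrable f := hi.integrable_indicator Metric.isOpen_ball.measurableSet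
  have hpc : ∀ p : ℝ × ℝ, Complex.polarCoord.symm p = circleMap 0 p.1 p.2 := fun p => by
    rw [Complex.polarCoord_symm_apply, circleMap, Complex.exp_mul_I]
    push_cast
    ring
  have hc : Continuous fun p : ℝ × ℝ => circleMap 0 p.1 p.2 := by
    unfold circleMap; fun_prop
  -- Fubini needs integrability in polar coordinates; it comes from the polar change of variables
  -- for the nonnegative integrand `‖f‖ₑ`.
  have hint : IntegrableOn (fun p : ℝ × ℝ => p.1 • f (circleMap 0 p.1 p.2))
      (Set.Ioi 0 ×ˢ Set.Ioo (-Real.pi) Real.pi) (volume.prod volume) := by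
    refine ⟨(measurable_fst.smul (hfm.comp hc.measurable)).aestronglyMeasurable, ?_⟩
    have h := Complex.lintegral_comp_polarCoord_symm fun z => ‖f z‖ₑ
    simp only [hpc] at h
    rw [hasFiniteIntegral_iff_enorm, ← Measure.volume_eq_prod, ← polarCoord_target]
    refine lt_of_eq_of_lt ?_ hfi.hasFiniteIntegral
    rw [← h]
    refine setLIntegral_congr_fun (by
      rw [polarCoord_target]; exact measurableSet_Ioi.prod measurableSet_Ioo) fun p hp => ?_
    rw [polarCoord_target] at hp
    have : (0 : ℝ) ≤ p.1 := hp.1.le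
    simp only [enorm_smul, Real.enorm_eq_ofReal this, smul_eq_mul]
  have h := Complex.integral_comp_polarCoord_symm f
  simp only [hpc] at h
  rw [← integral_indicator Metric.isOpen_ball.measurableSet, ← hf, ← h, polarCoord_target,
    Measure.volume_eq_prod, setIntegral_prod _ hint]
  have hin : ∀ r ∈ Set.Ioi (0 : ℝ),
      ∫ θ in Set.Ioo (-Real.pi) Real.pi, r • f (circleMap 0 r θ) =
        (Set.Ioo 0 1).indicator (fun r : ℝ => (r : ℂ) * (2 * Real.pi * g 0)) r := by
    intro r hr
    have hr : 0 < r := hr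
    have hn : ∀ θ, ‖circleMap 0 r θ‖ = r := fun θ => by simp [abs_of_pos hr]
    rw [integral_smul]
    by_cases h1 : r < 1
    · rw [Set.indicator_of_mem (show r ∈ Set.Ioo (0 : ℝ) 1 from ⟨hr, h1⟩),
        ← (setIntegral_congr_fun measurableSet_Ioo fun θ _ => (Set.indicator_of_mem (by simpa [hn] using h1) g).symm :
        ∫ θ in Set.Ioo (-Real.pi) Real.pi, g (circleMap 0 r θ) = _),
        integral_circleMap_eq hr (hg.mono (Metric.closedBall_subset_ball h1)),
        Complex.real_smul, Complex.real_smul]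
      push_cast
      ring
    · rw [Set.indicator_of_notMem fun h => h1 h.2, setIntegral_congr_fun measurableSet_Ioo
        fun θ _ => Set.indicator_of_notMem (by simpa [hn] using h1) g]
      simp
  rw [setIntegral_congr_fun measurableSet_Ioi hin, setIntegral_indicator measurableSet_Ioo,
    Set.inter_eq_right.2 Set.Ioo_subset_Ioi_self, integral_mul_const,
    ← integral_Ioc_eq_integral_Ioo, ← intervalIntegral.integral_of_le zero_le_one,
    intervalIntegral.integral_ofReal, integral_id]
  push_cast
  ring

/-- The real determinant of multiplication by `f'` is the norm of `f'` from `ℂ` to `ℝ`. This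
supplies the Jacobian for conformal changes of variables. -/
theorem hasFDerivAt_and_det_of_hasDerivAt {f : ℂ → ℂ} {f' z : ℂ} (h : HasDerivAt f f' z) :
    ∃ L : ℂ →L[ℝ] ℂ, HasFDerivAt f L z ∧ |L.det| = ‖f'‖ ^ 2 := by
  refine ⟨_, h.hasFDerivAt.restrictScalars ℝ, ?_⟩
  simp [ContinuousLinearMap.det, LinearMap.det_restrictScalars, Algebra.norm_complex_eq,
    Complex.normSq_eq_norm_sq]

/-- The Cayley transform of the upper half-plane onto the unit disc sending `w` to `0`. -/
noncomputable def cayley (w z : ℂ) : ℂ := (z - w) / (z - conj w)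

/-- The derivative of the Cayley transform. -/
noncomputable def cayleyDeriv (w z : ℂ) : ℂ := (w - conj w) / (z - conj w) ^ 2

/-- The inverse of the Cayley transform. -/
noncomputable def cayleyInv (w ζ : ℂ) : ℂ := (w - conj w * ζ) / (1 - ζ)

theorem sub_conj_im (w z : ℂ) : (z - conj w).im = z.im + w.im := by simp

theorem sub_conj_ne_zero {w z : ℂ} (hw : 0 < w.im) (hz : 0 < z.im) : z - conj w ≠ 0 := fun h => by
  have := sub_conj_im w z
  rw [h, Complex.zero_im] at this
  linarith

theorem one_sub_ne_zero_of_mem_ball {ζ : ℂ} (h : ζ ∈ Metric.ball (0 : ℂ) 1) : 1 - ζ ≠ 0 := by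
  intro h0
  rw [← sub_eq_zero.1 h0] at h
  simp at h

theorem hasDerivAt_cayley {w z : ℂ} (hw : 0 < w.im) (hz : 0 < z.im) :
    HasDerivAt (cayley w) (cayleyDeriv w z) z := by
  have hne := sub_conj_ne_zero hw hz
  have h := ((hasDerivAt_id z).sub_const w).div ((hasDerivAt_id z).sub_const (conj w)) hne
  convert! h using 1
  simp only [cayleyDeriv, id]
  ring

theorem cayleyInv_cayley {w z : ℂ} (hw : 0 < w.im) (hz : 0 < z.im) :
    cayleyInv w (cayley w z) = z := by
  have hne := sub_conj_ne_zero hw hz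
  have hne2 := sub_conj_ne_zero hw hw
  have h3 : 1 - cayley w z ≠ 0 := by
    rw [cayley, one_sub_div hne]
    refine div_ne_zero ?_ hne
    rwa [sub_sub_sub_cancel_left]
  rw [cayleyInv, div_eq_iff h3, cayley]
  field_simp
  ring

theorem cayley_mem_ball {w z : ℂ} (hw : 0 < w.im) (hz : 0 < z.im) :
    cayley w z ∈ Metric.ball (0 : ℂ) 1 := by
  have hne := sub_conj_ne_zero hw hz
  rw [mem_ball_zero_iff, cayley, norm_div, div_lt_one (norm_pos_iff.2 hne)]
  refine lt_of_pow_lt_pow_left₀ 2 (norm_nonneg _) ?_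
  rw [← Complex.normSq_eq_norm_sq, ← Complex.normSq_eq_norm_sq, Complex.normSq_apply,
    Complex.normSq_apply]
  simp only [Complex.sub_re, Complex.sub_im, Complex.conj_re, Complex.conj_im]
  -- The difference `|z - conj w|² - |z - w|²` equals `4 Im z Im w`.
  nlinarith [mul_pos hw hz]

theorem cayleyInv_im_pos {w ζ : ℂ} (hw : 0 < w.im) (h : ζ ∈ Metric.ball (0 : ℂ) 1) :
    0 < (cayleyInv w ζ).im := by
  have hne := one_sub_ne_zero_of_mem_ball h
  have h1 : ζ.re * ζ.re + ζ.im * ζ.im < 1 := by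
    rw [← Complex.normSq_apply, Complex.normSq_eq_norm_sq]
    have := mem_ball_zero_iff.1 h
    have := norm_nonneg ζ
    nlinarith
  have e : (cayleyInv w ζ).im =
      w.im * (1 - (ζ.re * ζ.re + ζ.im * ζ.im)) / Complex.normSq (1 - ζ) := by
    rw [cayleyInv, Complex.div_im, ← sub_div]
    congr 1
    simp only [Complex.sub_re, Complex.sub_im, Complex.mul_re, Complex.mul_im, Complex.conj_re,
      Complex.conj_im, Complex.one_re, Complex.one_im]
    ring
  rw [e]
  exact div_pos (mul_pos hw (by linarith)) (Complex.normSq_pos.2 hne)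

theorem cayley_cayleyInv {w ζ : ℂ} (hw : 0 < w.im) (h : ζ ∈ Metric.ball (0 : ℂ) 1) :
    cayley w (cayleyInv w ζ) = ζ := by
  have hne := one_sub_ne_zero_of_mem_ball h
  have hne2 := sub_conj_ne_zero hw (cayleyInv_im_pos hw h)
  rw [cayley, div_eq_iff hne2, cayleyInv]
  field_simp
  ring

theorem cayley_image {w : ℂ} (hw : 0 < w.im) :
    cayley w '' upperHalfPlaneSet = Metric.ball 0 1 := by
  ext ζ
  constructor
  · rintro ⟨z, hz, rfl⟩
    exact cayley_mem_ball hw hz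
  · exact fun h => ⟨_, cayleyInv_im_pos hw h, cayley_cayleyInv hw h⟩

theorem cayley_injOn {w : ℂ} (hw : 0 < w.im) : Set.InjOn (cayley w) upperHalfPlaneSet :=
  Set.LeftInvOn.injOn (f₁' := cayleyInv w) fun _ hz => cayleyInv_cayley hw hz

theorem differentiableOn_cayleyInv (w : ℂ) :
    DifferentiableOn ℂ (cayleyInv w) (Metric.ball 0 1) := by
  intro ζ h
  have hne := one_sub_ne_zero_of_mem_ball h
  exact ((by fun_prop : DifferentiableAt ℂ (fun ζ => w - conj w * ζ) ζ).div
    (by fun_prop : DifferentiableAt ℂ (fun ζ => 1 - ζ) ζ) hne).differentiableWithinAt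

theorem exists_fderiv_cayley {w : ℂ} (hw : 0 < w.im) : ∃ L : ℂ → ℂ →L[ℝ] ℂ,
    (∀ z ∈ upperHalfPlaneSet, HasFDerivWithinAt (cayley w) (L z) upperHalfPlaneSet z) ∧
    ∀ z ∈ upperHalfPlaneSet, |(L z).det| = ‖cayleyDeriv w z‖ ^ 2 := by
  have h : ∀ z, ∃ L : ℂ →L[ℝ] ℂ, z ∈ upperHalfPlaneSet →
      HasFDerivWithinAt (cayley w) L upperHalfPlaneSet z ∧ |L.det| = ‖cayleyDeriv w z‖ ^ 2 := by
    intro z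
    by_cases hz : z ∈ upperHalfPlaneSet
    · obtain ⟨L, h1, h2⟩ := hasFDerivAt_and_det_of_hasDerivAt (hasDerivAt_cayley hw hz)
      exact ⟨L, fun _ => ⟨h1.hasFDerivWithinAt, h2⟩⟩
    · exact ⟨0, fun h => absurd h hz⟩
  choose L hL using h
  exact ⟨L, fun z hz => (hL z hz).1, fun z hz => (hL z hz).2⟩

theorem differentiableOn_cayleyDeriv {w : ℂ} (hw : 0 < w.im) :
    DifferentiableOn ℂ (cayleyDeriv w) upperHalfPlaneSet := by
  intro z hz
  have hne := sub_conj_ne_zero hw hz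
  exact ((by fun_prop : DifferentiableAt ℂ (fun _ => w - conj w) z).div
    (by fun_prop : DifferentiableAt ℂ (fun z => (z - conj w) ^ 2) z)
    (pow_ne_zero 2 hne)).differentiableWithinAt

/-- The integral of `|φ'|²` is the area of the image of `φ`, here the unit disc. -/
theorem memLp_cayleyDeriv {w : ℂ} (hw : 0 < w.im) :
    MemLp (cayleyDeriv w) 2 areaMeasure := by
  have hm : AEStronglyMeasurable (cayleyDeriv w) areaMeasure :=
    (differentiableOn_cayleyDeriv hw).continuousOn.aestronglyMeasurable
      isOpen_upperHalfPlaneSet.measurableSet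
  rw [memLp_two_iff_integrable_sq_norm hm]
  obtain ⟨L, hL, hdet⟩ := exists_fderiv_cayley hw
  have h := (integrableOn_image_iff_integrableOn_abs_det_fderiv_smul volume
    isOpen_upperHalfPlaneSet.measurableSet hL (cayley_injOn hw) fun _ => (1 : ℝ)).1 (by
      rw [cayley_image hw]
      exact integrableOn_const measure_ball_lt_top.ne)
  refine (integrableOn_congr_fun (fun z hz => ?_) isOpen_upperHalfPlaneSet.measurableSet).1 h
  simp only [hdet z hz, smul_eq_mul, mul_one]

/-- The reproducing property of the Bergman kernel, in terms of the Cayley transform. -/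
theorem integral_conj_cayleyDeriv_mul {w : ℂ} (hw : 0 < w.im) {F : ℂ → ℂ}
    (hF : DifferentiableOn ℂ F upperHalfPlaneSet) (hF2 : MemLp F 2 areaMeasure) :
    ∫ z in upperHalfPlaneSet, conj (cayleyDeriv w z) * F z =
      Real.pi * (w - conj w) * F w := by
  obtain ⟨L, hL, hdet⟩ := exists_fderiv_cayley hw
  have hmeas := isOpen_upperHalfPlaneSet.measurableSet
  have hww := sub_conj_ne_zero hw hw
  have hd0 : ∀ z ∈ upperHalfPlaneSet, cayleyDeriv w z ≠ 0 := fun z hz =>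
    div_ne_zero hww (pow_ne_zero 2 (sub_conj_ne_zero hw hz))
  -- With `φ = cayley w`, `conj(φ') F = |φ'|² (F / φ')`, so the integral becomes that of `g = (F /
  -- φ') ∘ φ⁻¹` over the disc. The mean value property gives `π g(0)`, where `φ⁻¹(0) = w` and `φ'(w)
  -- = 1/(w - conj w)`.
  set g : ℂ → ℂ := fun ζ => F (cayleyInv w ζ) / cayleyDeriv w (cayleyInv w ζ) with hg
  have hmaps : Set.MapsTo (cayleyInv w) (Metric.ball 0 1) upperHalfPlaneSet :=
    fun ζ h => cayleyInv_im_pos hw h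
  have hgd : DifferentiableOn ℂ g (Metric.ball 0 1) :=
    (hF.comp (differentiableOn_cayleyInv w) hmaps).div
      ((differentiableOn_cayleyDeriv hw).comp (differentiableOn_cayleyInv w) hmaps)
      fun ζ h => hd0 _ (hmaps h)
  have hpt : Set.EqOn (fun z => |(L z).det| • g (cayley w z))
      (fun z => conj (cayleyDeriv w z) * F z) upperHalfPlaneSet := by
    intro z hz
    simp only [hg]
    rw [hdet z hz, cayleyInv_cayley hw hz, Complex.real_smul, ← Complex.normSq_eq_norm_sq,
      Complex.normSq_eq_conj_mul_self, mul_assoc, mul_div_cancel₀ _ (hd0 z hz)]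
  have hint : IntegrableOn (fun z => conj (cayleyDeriv w z) * F z) upperHalfPlaneSet := by
    have h := MemLp.integrable_mul (p := 2) (q := 2) (memLp_cayleyDeriv hw).star hF2
    exact h
  have hgi : IntegrableOn g (Metric.ball 0 1) := by
    rw [← cayley_image hw, integrableOn_image_iff_integrableOn_abs_det_fderiv_smul volume
      hmeas hL (cayley_injOn hw)]
    exact (integrableOn_congr_fun hpt hmeas).2 hint
  have h := integral_unitBall_eq hgd hgi
  rw [← cayley_image hw, integral_image_eq_integral_abs_det_fderiv_smul volume
    hmeas hL (cayley_injOn hw), setIntegral_congr_fun hmeas hpt] at h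
  rw [h, hg]
  have h0 : cayleyInv w 0 = w := by simp [cayleyInv]
  simp only [h0, cayleyDeriv]
  field_simp

/-! ### The Bergman kernel of the half-plane. -/

theorem kernelG_zero_eq {w : ℂ} (hw : 0 < w.im) (z : ℂ) :
    kernelG 0 z w = (-1 / (Real.pi * (w - conj w))) * cayleyDeriv w z := by
  have hww := sub_conj_ne_zero hw hw
  have hpi : (Real.pi : ℂ) ≠ 0 := by exact_mod_cast Real.pi_ne_zero
  rw [kernelG, cayleyDeriv]
  simp only [Int.cast_zero, zero_mul, add_zero]
  -- At the pole `z = conj w` both sides are `0` by the convention for division by zero, so the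
  -- identity holds for every `z` and can be used as an equality of functions.
  by_cases h : z - conj w = 0
  · simp [h]
  · field_simp

theorem differentiableOn_kernelG {w : ℂ} (hw : 0 < w.im) :
    DifferentiableOn ℂ (fun z => kernelG 0 z w) upperHalfPlaneSet := by
  rw [funext (kernelG_zero_eq hw)]
  exact (differentiableOn_cayleyDeriv hw).const_mul _

theorem memLp_kernelG {w : ℂ} (hw : 0 < w.im) :
    MemLp (fun z => kernelG 0 z w) 2 areaMeasure := by
  rw [funext (kernelG_zero_eq hw)]
  exact (memLp_cayleyDeriv hw).const_mul _

/-- The reproducing property of the Bergman kernel of the upper half-plane. -/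
theorem integral_conj_kernelG_mul {w : ℂ} (hw : 0 < w.im) {F : ℂ → ℂ}
    (hF : DifferentiableOn ℂ F upperHalfPlaneSet) (hF2 : MemLp F 2 areaMeasure) :
    ∫ z in upperHalfPlaneSet, conj (kernelG 0 z w) * F z = F w := by
  have hww := sub_conj_ne_zero hw hw
  have hww' := sub_ne_zero.2 (sub_ne_zero.1 hww).symm
  have hpi : (Real.pi : ℂ) ≠ 0 := by exact_mod_cast Real.pi_ne_zero
  simp only [kernelG_zero_eq hw, map_mul, mul_assoc]
  rw [integral_const_mul, integral_conj_cayleyDeriv_mul hw hF hF2]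
  simp only [map_div₀, map_neg, map_one, map_mul, map_sub, Complex.conj_conj, Complex.conj_ofReal]
  field_simp
  ring

/-- A square-integrable holomorphic function as an element of the Bergman space. -/
noncomputable def Bergman.mk (F : ℂ → ℂ) (hF : DifferentiableOn ℂ F upperHalfPlaneSet)
    (hF2 : MemLp F 2 areaMeasure) : Bergman := ⟨hF2.toLp F, F, hF, hF2.coeFn_toLp⟩

theorem bergmanEval_eq_of_ae_eq {f : Bergman} {F : ℂ → ℂ}
    (hF : DifferentiableOn ℂ F upperHalfPlaneSet) (h : bergmanIncl f =ᵐ[areaMeasure] F) (z : ℍ) :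
    bergmanEval z f = F z :=
  eqOn_of_ae_eq_areaMeasure (holRep_differentiableOn f) hF ((holRep_ae_eq f).symm.trans h) z.im_pos

theorem bergmanIncl_mk (F : ℂ → ℂ) (hF : DifferentiableOn ℂ F upperHalfPlaneSet)
    (hF2 : MemLp F 2 areaMeasure) : bergmanIncl (Bergman.mk F hF hF2) =ᵐ[areaMeasure] F :=
  hF2.coeFn_toLp

theorem memLp_holRep (f : Bergman) : MemLp (holRep f) 2 areaMeasure :=
  (memLp_congr_ae (holRep_ae_eq f)).1 (Lp.memLp _)

/-- The Bergman kernel of the upper half-plane at `w`. -/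
noncomputable def bergmanKernel (w : ℍ) : Bergman :=
  Bergman.mk (fun z => kernelG 0 z w) (differentiableOn_kernelG w.im_pos) (memLp_kernelG w.im_pos)

theorem bergmanEval_bergmanKernel (z w : ℍ) : bergmanEval z (bergmanKernel w) = kernelG 0 z w :=
  bergmanEval_eq_of_ae_eq (differentiableOn_kernelG w.im_pos) (bergmanIncl_mk _ _ _) z

theorem inner_bergmanKernel_eq_integral (w : ℍ) (f : Lp ℂ 2 areaMeasure) :
    ⟪bergmanIncl (bergmanKernel w), f⟫_ℂ =
      ∫ z in upperHalfPlaneSet, conj (kernelG 0 z w) * f z := by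
  rw [L2.inner_def]
  refine integral_congr_ae ?_
  filter_upwards [bergmanIncl_mk (fun z => kernelG 0 z w) (differentiableOn_kernelG w.im_pos)
    (memLp_kernelG w.im_pos)] with z hz
  rw [bergmanKernel, hz, RCLike.inner_apply, mul_comm]

theorem inner_bergmanKernel (w : ℍ) (f : Bergman) : ⟪bergmanKernel w, f⟫_ℂ = bergmanEval w f := by
  have h : ⟪bergmanKernel w, f⟫_ℂ = ⟪bergmanIncl (bergmanKernel w), bergmanIncl f⟫_ℂ := rfl
  rw [h, inner_bergmanKernel_eq_integral]
  refine Eq.trans (integral_congr_ae ?_) (integral_conj_kernelG_mul w.im_pos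
    (holRep_differentiableOn f) (memLp_holRep f))
  filter_upwards [holRep_ae_eq f] with z hz
  rw [hz]
  rfl

/-! ### Toeplitz operators of vertical half-lines as translations. -/

/-- The real axis is a proper real subspace, hence null. It must be discarded when translating,
since `[s, ∞)` is closed and the half-plane is open. -/
theorem ae_im_ne_zero : ∀ᵐ z : ℂ, z.im ≠ 0 := by
  have h := Measure.addHaar_submodule (volume : Measure ℂ) (LinearMap.ker Complex.imLm) (by
    intro h
    have : Complex.I ∈ LinearMap.ker Complex.imLm := by rw [h]; trivial
    simp at this)
  rw [ae_iff]
  convert h using 2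
  ext z
  simp

theorem setIntegral_indicator_Ici_im {s : ℝ} (hs : 0 ≤ s) (h : ℂ → ℂ) :
    ∫ z in upperHalfPlaneSet, (Set.Ici s).indicator (fun _ => (1 : ℂ)) z.im * h z =
      ∫ z in upperHalfPlaneSet, h (z + s * Complex.I) := by
  have hm := isOpen_upperHalfPlaneSet.measurableSet
  rw [← integral_indicator hm, ← integral_indicator hm,
    ← integral_add_right_eq_self _ ((s : ℂ) * Complex.I)]
  refine integral_congr_ae ?_
  filter_upwards [ae_im_ne_zero] with z hz
  have him : (z + s * Complex.I).im = z.im + s := by simp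
  rcases lt_or_gt_of_ne hz with h0 | h0
  · rw [Set.indicator_of_notMem (show z ∉ upperHalfPlaneSet from not_lt.2 h0.le)]
    refine Set.indicator_apply_eq_zero.2 fun _ => ?_
    rw [him, Set.indicator_of_notMem (fun hc => absurd (Set.mem_Ici.1 hc) (by linarith)), zero_mul]
  · rw [Set.indicator_of_mem (show z ∈ upperHalfPlaneSet from h0), Set.indicator_of_mem
      (show z + s * Complex.I ∈ upperHalfPlaneSet from
        (add_pos_of_pos_of_nonneg h0 hs).trans_eq him.symm), him,
      Set.indicator_of_mem (show z.im + s ∈ Set.Ici s from le_add_of_nonneg_left h0.le), one_mul]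

theorem memLp_comp_add_mul_I {s : ℝ} (hs : 0 ≤ s) {F : ℂ → ℂ} (hF : MemLp F 2 areaMeasure) :
    MemLp (fun z => F (z + s * Complex.I)) 2 areaMeasure := by
  have hm := isOpen_upperHalfPlaneSet.measurableSet
  have h1 : MemLp (upperHalfPlaneSet.indicator F) 2 := (memLp_indicator_iff_restrict hm).2 hF
  have h2 := (h1.comp_measurePreserving
    (measurePreserving_add_right volume ((s : ℂ) * Complex.I))).restrict upperHalfPlaneSet
  refine (memLp_congr_ae ?_).1 h2
  filter_upwards [ae_restrict_mem hm] with z hz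
  have hz : 0 < z.im := hz
  have hz' : 0 < (z + s * Complex.I).im := by
    simp only [Complex.add_im, Complex.mul_im, Complex.ofReal_re, Complex.I_im, mul_one,
      Complex.ofReal_im, Complex.I_re, mul_zero, add_zero]
    linarith
  exact Set.indicator_of_mem (show z + s * Complex.I ∈ upperHalfPlaneSet from hz') F

theorem bergmanEval_bergmanProj (w : ℍ) (f : Lp ℂ 2 areaMeasure) :
    bergmanEval w (bergmanProj f) =
      ∫ z in upperHalfPlaneSet, conj (kernelG 0 z w) * f z := by
  rw [← inner_bergmanKernel, ← inner_conj_symm, inner_bergmanProj, inner_conj_symm,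
    inner_bergmanKernel_eq_integral]

/-- The Toeplitz operator with symbol `χ_{[s, ∞)}(Im z)` is the vertical translation by `2s`. -/
theorem bergmanEval_toeplitz_Ici {s : ℝ} (hs : 0 ≤ s) (f : Bergman) (w w' : ℍ)
    (hw : (w' : ℂ) = w + 2 * s * Complex.I) :
    bergmanEval w (toeplitz (verticalSymbol (Set.Ici s) measurableSet_Ici) f) =
      bergmanEval w' f := by
  rw [toeplitz, ContinuousLinearMap.comp_apply, bergmanEval_bergmanProj]
  have h1 : ∫ z in upperHalfPlaneSet, conj (kernelG 0 z w) * ((mulSymbol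
      (verticalSymbol (Set.Ici s) measurableSet_Ici) ∘L bergmanIncl) f) z =
      ∫ z in upperHalfPlaneSet, (Set.Ici s).indicator (fun _ => (1 : ℂ)) z.im *
        (conj (kernelG 0 z w) * holRep f z) := by
    refine integral_congr_ae ?_
    filter_upwards [mulSymbol_verticalSymbol_ae (Set.Ici s) measurableSet_Ici (bergmanIncl f),
      holRep_ae_eq f] with z h1 h2
    rw [ContinuousLinearMap.comp_apply, h1, h2]
    ring
  have him : 0 < ((w : ℂ) + s * Complex.I).im := by
    have : 0 < (w : ℂ).im := w.im_pos
    simp only [Complex.add_im, Complex.mul_im, Complex.ofReal_re, Complex.I_im, mul_one,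
      Complex.ofReal_im, Complex.I_re, mul_zero, add_zero]
    linarith
  -- Conjugation reverses the sign of `s i`, so a translation of `z` becomes the same translation of
  -- `w`.
  have hk : ∀ z : ℂ, kernelG 0 (z + s * Complex.I) w = kernelG 0 z (w + s * Complex.I) := by
    intro z
    simp only [kernelG, map_add, map_mul, Complex.conj_ofReal, Complex.conj_I]
    congr 4
    ring
  rw [h1, setIntegral_indicator_Ici_im hs]
  simp only [hk]
  have hmaps : Set.MapsTo (fun z : ℂ => z + s * Complex.I) upperHalfPlaneSet
      upperHalfPlaneSet := fun z hz => by
    have hz : 0 < z.im := hz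
    show 0 < (z + s * Complex.I).im
    simp
    linarith
  -- The translated function is evaluated at the translated base point; the two shifts by `s i` add
  -- up to `2 s i`.
  rw [integral_conj_kernelG_mul (F := fun z => holRep f (z + s * Complex.I)) him
    ((holRep_differentiableOn f).comp (by fun_prop) hmaps)
    (memLp_comp_add_mul_I hs (memLp_holRep f))]
  show _ = holRep f w'
  rw [hw]
  congr 1
  ring

theorem verticalSymbol_union {s t : Set ℝ} (hs : MeasurableSet s) (ht : MeasurableSet t)
    (hst : Disjoint s t) :
    verticalSymbol (s ∪ t) (hs.union ht) = verticalSymbol s hs + verticalSymbol t ht := by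
  unfold verticalSymbol
  rw [← MemLp.toLp_add]
  congr 1
  funext z
  rw [Set.indicator_union_of_disjoint hst]
  rfl

theorem toeplitz_union {s t : Set ℝ} (hs : MeasurableSet s) (ht : MeasurableSet t)
    (hst : Disjoint s t) :
    toeplitz (verticalSymbol (s ∪ t) (hs.union ht)) =
      toeplitz (verticalSymbol s hs) + toeplitz (verticalSymbol t ht) := by
  rw [verticalSymbol_union hs ht hst, toeplitz, mulSymbol, map_add]
  ext1 f
  simp [toeplitz, mulSymbol]

theorem toeplitz_Ico {a b : ℝ} (hab : a ≤ b) :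
    toeplitz (verticalSymbol (Set.Ico a b) measurableSet_Ico) =
      toeplitz (verticalSymbol (Set.Ici a) measurableSet_Ici) -
        toeplitz (verticalSymbol (Set.Ici b) measurableSet_Ici) := by
  have h := toeplitz_union (measurableSet_Ico (a := a) (b := b)) (measurableSet_Ici (a := b))
    (Set.disjoint_left.2 fun x hx hx' => not_lt.2 (Set.mem_Ici.1 hx') hx.2)
  rw [eq_sub_iff_add_eq, ← h]
  congr 1
  unfold verticalSymbol
  congr 1
  funext z
  rw [Set.Ico_union_Ici_eq_Ici hab]

/-- Translation by `i` on the Bergman space, as a Toeplitz operator. -/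
noncomputable def shiftOp : Bergman →L[ℂ] Bergman :=
  toeplitz (verticalSymbol (Set.Ici (1 / 2)) measurableSet_Ici)

theorem shiftOp_nonneg : 0 ≤ shiftOp := toeplitz_nonneg _ _

theorem bergmanEval_shiftOp_pow (m : ℕ) (f : Bergman) (w w' : ℍ)
    (hw : (w' : ℂ) = w + m * Complex.I) :
    bergmanEval w ((shiftOp ^ m) f) = bergmanEval w' f := by
  induction m generalizing f w with
  | zero =>
    have : w' = w := UpperHalfPlane.ext (by simpa using hw)
    simp [this]
  | succ k ih =>
    have him : 0 < ((w : ℂ) + Complex.I).im := by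
      have : 0 < (w : ℂ).im := w.im_pos
      simp only [Complex.add_im, Complex.I_im]
      linarith
    rw [pow_succ', mul_apply_eq_comp, shiftOp,
      bergmanEval_toeplitz_Ici (by norm_num) _ w ⟨w + Complex.I, him⟩ (by push_cast; simp)]
    refine ih f _ ?_
    rw [hw]
    push_cast
    ring

theorem toeplitz_Ici_natCast (k : ℕ) :
    toeplitz (verticalSymbol (Set.Ici (k : ℝ)) measurableSet_Ici) = shiftOp ^ (2 * k) := by
  refine ContinuousLinearMap.ext fun f => eq_of_bergmanEval_eq fun w => ?_
  have him : 0 < ((w : ℂ) + 2 * (k : ℝ) * Complex.I).im := by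
    have : 0 < w.im := w.im_pos
    simp
    positivity
  rw [bergmanEval_toeplitz_Ici (Nat.cast_nonneg k) f w ⟨_, him⟩ rfl,
    bergmanEval_shiftOp_pow (2 * k) f w ⟨_, him⟩ (by push_cast; rfl)]

/-- The complement `1 - shiftOp` is the Toeplitz operator of `χ_{[0,1/2)}(Im z)`, hence positive. -/
theorem shiftOp_le_one : shiftOp ≤ 1 := by
  have h1 := toeplitz_Ico (a := 0) (b := 1 / 2) (by norm_num)
  have h2 : toeplitz (verticalSymbol (Set.Ici (0 : ℝ)) measurableSet_Ici) = 1 := by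
    have := toeplitz_Ici_natCast 0
    simpa using this
  rw [h2] at h1
  exact sub_nonneg.1 (h1 ▸ toeplitz_nonneg _ _)

theorem spectrum_shiftOp {x : ℝ} (hx : x ∈ spectrum ℝ shiftOp) : x ∈ Set.Icc (0 : ℝ) 1 := by
  refine ⟨spectrum_nonneg_of_nonneg shiftOp_nonneg hx, ?_⟩
  have h := (CStarAlgebra.norm_le_one_iff_of_nonneg shiftOp shiftOp_nonneg).2 shiftOp_le_one
  have h1 : ‖(1 : Bergman →L[ℂ] Bergman)‖ ≤ 1 := ContinuousLinearMap.norm_id_le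
  exact (le_abs_self x).trans ((spectrum.norm_le_norm_mul_of_mem hx).trans
    (mul_le_one₀ h (norm_nonneg _) h1))

theorem bergmanEval_shiftOp_pow_bergmanKernel (m : ℕ) (z w : ℍ) :
    bergmanEval z ((shiftOp ^ m) (bergmanKernel w)) = kernelG m z w := by
  have him : 0 < ((z : ℂ) + m * Complex.I).im := by
    have : 0 < z.im := z.im_pos
    simp
    positivity
  rw [bergmanEval_shiftOp_pow m _ z ⟨_, him⟩ rfl, bergmanEval_bergmanKernel, kernelG, kernelG]
  push_cast
  congr 3
  ring

/-! ### Functional calculus of the translation as a Laplace integral. -/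

theorem neg_I_mul_sub_conj_re_pos (z w : ℍ) :
    0 < (-Complex.I * ((z : ℂ) - conj (w : ℂ))).re := by
  have h1 : 0 < z.im := z.im_pos
  have h2 : 0 < w.im := w.im_pos
  simp
  positivity

/-- With `u = z - conj w`, `(-i u + m)² = -(u + m i)²`, so `G_m` is `1/π` times the Laplace
transform of `t` at `-i u + m`. Isolating `e^{-mt}` shows that powers of `shiftOp` act as powers of
`e^{-t}`. -/
theorem kernelG_eq_integral (m : ℕ) (z w : ℍ) :
    kernelG m z w = 1 / (Real.pi : ℂ) * ∫ t in Set.Ioi (0 : ℝ),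
      (t : ℂ) * Complex.exp (-(-Complex.I * ((z : ℂ) - conj (w : ℂ))) * t) *
        ((Real.exp (-t) ^ m : ℝ) : ℂ) := by
  have hre : 0 < (-Complex.I * ((z : ℂ) - conj (w : ℂ)) + m).re := by
    have := neg_I_mul_sub_conj_re_pos z w
    rw [Complex.add_re, Complex.natCast_re]
    positivity
  have h := integral_mul_cexp_neg hre
  have e : ∀ t : ℝ, (t : ℂ) * Complex.exp (-(-Complex.I * ((z : ℂ) - conj (w : ℂ))) * t) *
      ((Real.exp (-t) ^ m : ℝ) : ℂ) =
      (t : ℂ) * Complex.exp (-(-Complex.I * ((z : ℂ) - conj (w : ℂ)) + m) * t) := by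
    intro t
    push_cast
    rw [mul_assoc, ← Complex.exp_nat_mul, ← Complex.exp_add]
    congr 2
    ring
  simp only [e]
  have hsq : (-Complex.I * ((z : ℂ) - conj (w : ℂ)) + m) ^ 2 =
      -((z : ℂ) - conj (w : ℂ) + m * Complex.I) ^ 2 := by
    linear_combination (((z : ℂ) - conj (w : ℂ)) ^ 2 + m ^ 2) * Complex.I_sq
  rw [h, hsq, kernelG]
  push_cast
  rw [one_div_mul_one_div, mul_neg, neg_div, one_div, one_div, inv_neg]

theorem integrableOn_mul_cexp_neg_mul_comp_exp {f : ℝ → ℝ} (hf : Continuous f) {a : ℂ}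
    (ha : 0 < a.re) :
    IntegrableOn (fun t : ℝ => (t : ℂ) * Complex.exp (-a * t) * (f (Real.exp (-t)) : ℂ))
      (Set.Ioi 0) := by
  obtain ⟨C, hC⟩ := (isCompact_Icc (a := (0 : ℝ)) (b := 1)).exists_bound_of_continuousOn
    hf.continuousOn
  refine ((integrableOn_mul_exp_neg ha).mul_const C).mono'
    (by fun_prop : Continuous _).aestronglyMeasurable ?_
  filter_upwards [ae_restrict_mem measurableSet_Ioi] with t ht
  have ht : 0 < t := ht
  rw [norm_mul, norm_mul, norm_cexp_neg_mul, Complex.norm_real, Real.norm_of_nonneg ht.le,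
    Complex.norm_real]
  gcongr
  exact hC _ ⟨(Real.exp_pos _).le, Real.exp_le_one_iff.2 (by linarith)⟩

theorem isSelfAdjoint_shiftOp : IsSelfAdjoint shiftOp := .of_nonneg shiftOp_nonneg

theorem bergmanEval_aeval_shiftOp (q : Polynomial ℝ) (z w : ℍ) :
    bergmanEval z (Polynomial.aeval shiftOp q (bergmanKernel w)) =
      1 / (Real.pi : ℂ) * ∫ t in Set.Ioi (0 : ℝ),
        (t : ℂ) * Complex.exp (-(-Complex.I * ((z : ℂ) - conj (w : ℂ))) * t) *
          ((q.eval (Real.exp (-t)) : ℝ) : ℂ) := by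
  induction q using Polynomial.induction_on' with
  | add p q hp hq =>
    have hi := fun q : Polynomial ℝ =>
      integrableOn_mul_cexp_neg_mul_comp_exp q.continuous (neg_I_mul_sub_conj_re_pos z w)
    rw [map_add, add_apply, map_add, hp, hq, ← mul_add, ← integral_add (hi p) (hi q)]
    simp only [Polynomial.eval_add, Complex.ofReal_add, mul_add]
  | monomial m r =>
    have e : Polynomial.aeval shiftOp (Polynomial.monomial m r) (bergmanKernel w) =
        (r : ℂ) • (shiftOp ^ m) (bergmanKernel w) := by
      rw [Polynomial.aeval_monomial, Algebra.algebraMap_eq_smul_one, smul_mul_assoc, one_mul]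
      rfl
    rw [e, map_smul, bergmanEval_shiftOp_pow_bergmanKernel, kernelG_eq_integral, smul_eq_mul,
      mul_left_comm, ← integral_const_mul]
    congr 2
    funext t
    rw [Polynomial.eval_monomial]
    push_cast
    ring

/-- Matrix coefficients of the continuous functional calculus of the translation operator
between Bergman kernels. -/
theorem bergmanEval_cfc_shiftOp {f : ℝ → ℝ} (hf : Continuous f) (z w : ℍ) :
    bergmanEval z (cfc f shiftOp (bergmanKernel w)) =
      1 / (Real.pi : ℂ) * ∫ t in Set.Ioi (0 : ℝ),
        (t : ℂ) * Complex.exp (-(-Complex.I * ((z : ℂ) - conj (w : ℂ))) * t) *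
          (f (Real.exp (-t)) : ℂ) := by
  set a := -Complex.I * ((z : ℂ) - conj (w : ℂ))
  have ha : 0 < a.re := neg_I_mul_sub_conj_re_pos z w
  set I := fun g : ℝ → ℝ => ∫ t in Set.Ioi (0 : ℝ),
    (t : ℂ) * Complex.exp (-a * t) * (g (Real.exp (-t)) : ℂ) with hI
  set M := ∫ t in Set.Ioi (0 : ℝ), t * Real.exp (-a.re * t)
  have hM : 0 ≤ M := setIntegral_nonneg measurableSet_Ioi fun t (ht : 0 < t) => by positivity
  -- Replacing `f` by a polynomial within `ε` on `[0, 1]` costs at most `ε C` over the two sides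
  -- together, since both the spectrum and the values `e^{-t}` lie there. The choice `ε = δ / (C +
  -- 1)` avoids dividing by zero.
  set C := ‖bergmanEval z‖ * ‖bergmanKernel w‖ + ‖1 / (Real.pi : ℂ)‖ * M with hC
  have hC0 : 0 ≤ C := by positivity
  rw [← sub_eq_zero, ← norm_le_zero_iff]
  refine le_of_forall_pos_le_add fun δ hδ => ?_
  obtain ⟨q, hq⟩ := exists_polynomial_near_of_continuousOn 0 1 f hf.continuousOn (δ / (C + 1))
    (by positivity)
  set ε := δ / (C + 1)
  have hε : 0 < ε := by positivity
  have hsa := isSelfAdjoint_shiftOp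
  have h1 : ‖bergmanEval z (cfc f shiftOp (bergmanKernel w)) -
      bergmanEval z (Polynomial.aeval shiftOp q (bergmanKernel w))‖ ≤
      ‖bergmanEval z‖ * (ε * ‖bergmanKernel w‖) := by
    rw [← map_sub, ← sub_apply, ← cfc_polynomial q shiftOp hsa,
      ← cfc_sub (R := ℝ) f q.eval shiftOp hf.continuousOn q.continuous.continuousOn]
    refine (ContinuousLinearMap.le_opNorm _ _).trans ?_
    gcongr
    refine (ContinuousLinearMap.le_opNorm _ _).trans ?_
    gcongr
    refine norm_cfc_le hε.le fun x hx => ?_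
    rw [Real.norm_eq_abs, abs_sub_comm]
    exact (hq x (spectrum_shiftOp hx)).le
  have h2 : ‖I q.eval - I f‖ ≤ ε * M := by
    simp only [hI]
    rw [← integral_sub (integrableOn_mul_cexp_neg_mul_comp_exp q.continuous ha)
      (integrableOn_mul_cexp_neg_mul_comp_exp hf ha), ← integral_const_mul]
    refine norm_integral_le_of_norm_le ((integrableOn_mul_exp_neg ha).const_mul ε) ?_
    filter_upwards [ae_restrict_mem measurableSet_Ioi] with t ht
    have ht : 0 < t := ht
    rw [← mul_sub, ← Complex.ofReal_sub, norm_mul, norm_mul, norm_cexp_neg_mul, Complex.norm_real,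
      Real.norm_of_nonneg ht.le, Complex.norm_real, mul_comm ε]
    gcongr
    exact (hq _ ⟨(Real.exp_pos _).le, Real.exp_le_one_iff.2 (by linarith)⟩).le
  have h3 : bergmanEval z (Polynomial.aeval shiftOp q (bergmanKernel w)) =
      1 / (Real.pi : ℂ) * I fun x => q.eval x := bergmanEval_aeval_shiftOp q z w
  calc ‖bergmanEval z (cfc f shiftOp (bergmanKernel w)) - 1 / (Real.pi : ℂ) * I f‖
      = ‖(bergmanEval z (cfc f shiftOp (bergmanKernel w)) -
          bergmanEval z (Polynomial.aeval shiftOp q (bergmanKernel w))) +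
          1 / (Real.pi : ℂ) * (I q.eval - I f)‖ := by
        rw [h3, mul_sub, sub_add_sub_cancel]
    _ ≤ ‖bergmanEval z‖ * (ε * ‖bergmanKernel w‖) + ‖1 / (Real.pi : ℂ)‖ * (ε * M) := by
        refine (norm_add_le _ _).trans (add_le_add h1 ?_)
        rw [norm_mul]
        gcongr
    _ = ε * C := by rw [hC]; ring
    _ ≤ 0 + δ := by
        rw [zero_add, div_mul_eq_mul_div, div_le_iff₀ (by positivity)]
        nlinarith

/-! ### Square roots of the Toeplitz operators and the kernel of the image of `P_T`. -/

/-- The function of the translation operator that equals `√T_{a_j}`. -/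
noncomputable def bandFn (n : ℕ) (i : Fin n) (x : ℝ) : ℝ :=
  if (i : ℕ) + 1 = n then x ^ (i : ℕ) else x ^ (i : ℕ) * Real.sqrt (1 - x ^ 2)

theorem continuous_bandFn (n : ℕ) (i : Fin n) : Continuous (bandFn n i) := by
  unfold bandFn
  split_ifs <;> fun_prop

theorem bandFn_nonneg (n : ℕ) (i : Fin n) {x : ℝ} (hx : 0 ≤ x) : 0 ≤ bandFn n i x := by
  unfold bandFn
  split_ifs <;> positivity

theorem cfc_pow_shiftOp (m : ℕ) : cfc (fun x : ℝ => x ^ m) shiftOp = shiftOp ^ m :=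
  cfc_pow_id shiftOp m isSelfAdjoint_shiftOp

theorem cfc_pow_sub_pow_shiftOp (k m : ℕ) :
    cfc (fun x : ℝ => x ^ k - x ^ m) shiftOp = shiftOp ^ k - shiftOp ^ m := by
  rw [cfc_sub (R := ℝ) (fun x => x ^ k) (fun x => x ^ m) shiftOp (by fun_prop) (by fun_prop),
    cfc_pow_shiftOp, cfc_pow_shiftOp]

theorem bandToeplitz_of_last {n : ℕ} {i : Fin n} (h : (i : ℕ) + 1 = n) :
    bandToeplitz n i = shiftOp ^ (2 * (i : ℕ)) := by
  rw [← toeplitz_Ici_natCast, bandToeplitz]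
  congr 1
  unfold verticalSymbol
  congr 1
  funext z
  have hi : (n : ℝ) - 1 = (i : ℕ) := by
    rw [sub_eq_iff_eq_add]
    exact_mod_cast h.symm
  rw [band, if_pos h, hi]

theorem bandToeplitz_of_not_last {n : ℕ} {i : Fin n} (h : (i : ℕ) + 1 ≠ n) :
    bandToeplitz n i = shiftOp ^ (2 * (i : ℕ)) - shiftOp ^ (2 * ((i : ℕ) + 1)) := by
  rw [← toeplitz_Ici_natCast, ← toeplitz_Ici_natCast, ← toeplitz_Ico (by push_cast; linarith),
    bandToeplitz]
  congr 1
  unfold verticalSymbol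
  congr 1
  funext z
  rw [band, if_neg h]
  push_cast
  rfl

/-- By uniqueness of the nonnegative square root it suffices to square `bandFn` on the spectrum.
That lies in `[0, 1]`, where `bandFn` is nonnegative and `√(1 - x²)` squares to `1 - x²`. -/
theorem sqrt_bandToeplitz (n : ℕ) (i : Fin n) :
    CFC.sqrt (bandToeplitz n i) = cfc (bandFn n i) shiftOp := by
  have hc := (continuous_bandFn n i).continuousOn (s := spectrum ℝ shiftOp)
  refine CFC.sqrt_unique ?_ (cfc_nonneg fun x hx => bandFn_nonneg n i (spectrum_shiftOp hx).1)
  rw [← cfc_mul _ _ shiftOp hc hc]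
  by_cases h : (i : ℕ) + 1 = n
  · rw [bandToeplitz_of_last h, ← cfc_pow_shiftOp]
    refine cfc_congr fun x _ => ?_
    simp only [bandFn, if_pos h]
    ring
  · rw [bandToeplitz_of_not_last h, ← cfc_pow_sub_pow_shiftOp]
    refine cfc_congr fun x hx => ?_
    obtain ⟨h0, h1⟩ := spectrum_shiftOp hx
    have hs := Real.mul_self_sqrt (show 0 ≤ 1 - x ^ 2 by nlinarith)
    simp only [bandFn, if_neg h]
    linear_combination (x ^ (i : ℕ)) ^ 2 * hs

theorem sqrt_bandToeplitz_mul (n : ℕ) (j k : Fin n) :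
    CFC.sqrt (bandToeplitz n j) * CFC.sqrt (bandToeplitz n k) =
      cfc (fun x => bandFn n j x * bandFn n k x) shiftOp := by
  rw [sqrt_bandToeplitz, sqrt_bandToeplitz,
    cfc_mul _ _ shiftOp (continuous_bandFn n j).continuousOn (continuous_bandFn n k).continuousOn]

/-- In `(A²)ⁿ` the evaluation `g ↦ g_k(w)` is represented by the Bergman kernel placed in slot `k`.
Since `P_T` is self-adjoint and fixes its image, projecting this vector represents the evaluation on
the image. -/
theorem kerFun_imagePT (n : ℕ) (w : ℍ) (k : Fin n) :
    (RKHS.kerFun (imagePT n) w (EuclideanSpace.single k (1 : ℂ)) : BergmanPow n) =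
      projPT n (PiLp.single 2 k (bergmanKernel w)) := by
  have hsa : ∀ (i : Fin n) (f g : Bergman),
      ⟪CFC.sqrt (bandToeplitz n i) f, g⟫_ℂ = ⟪f, CFC.sqrt (bandToeplitz n i) g⟫_ℂ := fun i f g => by
    have h : IsSelfAdjoint (CFC.sqrt (bandToeplitz n i)) := .of_nonneg (CFC.sqrt_nonneg _)
    exact h.isSymmetric f g
  suffices h : RKHS.kerFun (imagePT n) w (EuclideanSpace.single k (1 : ℂ)) =
      ⟨projPT n (PiLp.single 2 k (bergmanKernel w)), LinearMap.mem_range_self _ _⟩ from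
    congrArg Subtype.val h
  refine ext_inner_right ℂ fun g => ?_
  have hg : projPT n (g : BergmanPow n) = g := by
    obtain ⟨f, hf⟩ := g.2
    have hf : projPT n f = g := hf
    rw [← hf, ← mul_apply_eq_comp, projPT_isIdempotentElem n]
  have hgw : (g w) k = bergmanEval w ((g : BergmanPow n) k) := rfl
  rw [RKHS.kerFun_inner, EuclideanSpace.inner_single_left, map_one, one_mul, hgw,
    ← inner_bergmanKernel]
  conv_lhs => rw [← hg, projPT_apply, inner_sum]
  rw [Submodule.coe_inner, PiLp.inner_apply]
  refine Finset.sum_congr rfl fun j _ => ?_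
  rw [projPT_apply, Finset.sum_eq_single k, PiLp.single_eq_same, hsa, hsa]
  · intro i _ hi
    rw [PiLp.single_eq_of_ne 2 hi, map_zero, map_zero]
  · simp

theorem kernelPT_eq (n : ℕ) (z w : ℍ) (j k : Fin n) :
    kernelPT n z w j k = bergmanEval z
      (cfc (fun x => bandFn n j x * bandFn n k x) shiftOp (bergmanKernel w)) := by
  have h : kernelPT n z w j k = bergmanEval z
      ((RKHS.kerFun (imagePT n) w (EuclideanSpace.single k (1 : ℂ)) : BergmanPow n) j) := by
    rw [kernelPT, Matrix.of_apply, ← RKHS.kerFun_apply]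
    rfl
  rw [h, kerFun_imagePT, ← sqrt_bandToeplitz_mul, projPT_apply, Finset.sum_eq_single k,
    PiLp.single_eq_same, mul_apply_eq_comp]
  · intro i _ hi
    rw [PiLp.single_eq_of_ne 2 hi, map_zero, map_zero]
  · simp

/-- The square roots are functions of one operator, so they commute. -/
theorem kernelPT_comm (n : ℕ) (z w : ℍ) (j k : Fin n) :
    kernelPT n z w j k = kernelPT n z w k j := by
  simp only [kernelPT_eq, mul_comm]

theorem kernelPT_last (n : ℕ) (z w : ℍ) (l : Fin n) (hl : (l : ℕ) + 1 = n) :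
    kernelPT n z w l l = kernelG (2 * ((n : ℤ) - 1)) z w := by
  have e : (fun x => bandFn n l x * bandFn n l x) = fun x => x ^ (2 * (l : ℕ)) := by
    funext x
    simp only [bandFn, if_pos hl]
    ring
  rw [kernelPT_eq, e, cfc_pow_shiftOp, bergmanEval_shiftOp_pow_bergmanKernel]
  congr 1
  push_cast
  omega

theorem kernelPT_not_last (n : ℕ) (z w : ℍ) (j k : Fin n) (hj : (j : ℕ) + 1 < n)
    (hk : (k : ℕ) + 1 < n) :
    kernelPT n z w j k =
      -kernelG (((j : ℤ) + 1) + ((k : ℤ) + 1)) z w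
        + kernelG (((j : ℤ) + 1) + ((k : ℤ) + 1) - 2) z w := by
  have e : cfc (fun x => bandFn n j x * bandFn n k x) shiftOp =
      shiftOp ^ ((j : ℕ) + k) - shiftOp ^ ((j : ℕ) + k + 2) := by
    rw [← cfc_pow_sub_pow_shiftOp]
    refine cfc_congr fun x hx => ?_
    obtain ⟨h0, h1⟩ := spectrum_shiftOp hx
    have hs := Real.mul_self_sqrt (show 0 ≤ 1 - x ^ 2 by nlinarith)
    simp only [bandFn, if_neg hj.ne, if_neg hk.ne]
    -- The two roots multiply to `1 - x²` on the spectrum, leaving the polynomial `x^(j+k) -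
    -- x^(j+k+2)`.
    linear_combination (x ^ (j : ℕ) * x ^ (k : ℕ)) * hs
  rw [kernelPT_eq, e, sub_apply, map_sub,
    bergmanEval_shiftOp_pow_bergmanKernel, bergmanEval_shiftOp_pow_bergmanKernel, sub_eq_neg_add]
  congr 3 <;> push_cast <;> ring

theorem kernelPT_mixed (n : ℕ) (z w : ℍ) (j l : Fin n) (hj : (j : ℕ) + 1 < n)
    (hl : (l : ℕ) + 1 = n) {p : ℂ}
    (hp : p = -Complex.I * ((z : ℂ) - conj (w : ℂ)) + ((j : ℂ) + 1) + ((n : ℂ) - 2)) :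
    kernelPT n z w j l = 1 / (Real.pi : ℂ) * ∫ t in Set.Ioi (0 : ℝ),
      (t : ℂ) * Complex.exp (-p * t) * (Real.sqrt (1 - Real.exp (-2 * t)) : ℂ) := by
  rw [kernelPT_eq, bergmanEval_cfc_shiftOp (f := fun x => bandFn n j x * bandFn n l x)
    ((continuous_bandFn n j).mul (continuous_bandFn n l))]
  congr 2
  funext t
  -- The indices start at `0` and `l = n - 1`, so `(j + 1) + (n - 2)` is `j + l`, the power of
  -- `e^{-t}` coming from the two `bandFn` factors.
  have hp' : p = -Complex.I * ((z : ℂ) - conj (w : ℂ)) + ((j : ℕ) + (l : ℕ) : ℕ) := by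
    have hn : (n : ℂ) = (l : ℕ) + 1 := by exact_mod_cast hl.symm
    rw [hp, hn]
    push_cast
    ring
  have hsq : Real.exp (-t) ^ 2 = Real.exp (-2 * t) := by
    rw [← Real.exp_nat_mul]
    congr 1
    push_cast
    ring
  have hexp : Complex.exp (-p * t) =
      Complex.exp (-(-Complex.I * ((z : ℂ) - conj (w : ℂ))) * t) *
        Complex.exp (-t) ^ ((j : ℕ) + (l : ℕ)) := by
    rw [← Complex.exp_nat_mul, ← Complex.exp_add, hp']
    congr 1
    ring
  simp only [bandFn, if_neg hj.ne, if_pos hl, hsq]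
  rw [hexp]
  push_cast
  ring

theorem mainTheorem4 (n : ℕ) (z w : ℍ) :
    (∀ l : Fin n, (l : ℕ) + 1 = n →
      kernelPT n z w l l = kernelG (2 * ((n : ℤ) - 1)) z w) ∧
    (∀ j k : Fin n, (j : ℕ) + 1 < n → (k : ℕ) + 1 < n →
      kernelPT n z w j k =
        -kernelG (((j : ℤ) + 1) + ((k : ℤ) + 1)) z w
          + kernelG (((j : ℤ) + 1) + ((k : ℤ) + 1) - 2) z w) ∧
    (∀ j l : Fin n, (j : ℕ) + 1 < n → (l : ℕ) + 1 = n → ∀ p : ℂ,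
      p = -Complex.I * ((z : ℂ) - conj (w : ℂ)) + ((j : ℂ) + 1) + ((n : ℂ) - 2) →
        laplaceJ p =
          (Real.sqrt Real.pi : ℂ) / 4 * (Complex.Gamma (p / 2) / Complex.Gamma (p / 2 + 3 / 2)) ∧
        kernelPT n z w j l = 1 / (Real.pi : ℂ) * laplaceJ p * (nielsenBeta p + 1 / (p + 1)) ∧
        kernelPT n z w j l = laplaceJ p / (2 * (Real.pi : ℂ)) *
          (harmonicFn ((p + 1) / 2) - harmonicFn (p / 2) + 2 / p) ∧
        kernelPT n z w l j = kernelPT n z w j l) := by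
  refine ⟨kernelPT_last n z w, kernelPT_not_last n z w, fun j l hj hl p hp => ?_⟩
  have hre : 0 < p.re := by
    have h1 := neg_I_mul_sub_conj_re_pos z w
    have h2 : p = -Complex.I * ((z : ℂ) - conj (w : ℂ)) + ((j : ℕ) + (l : ℕ) : ℕ) := by
      have hn : (n : ℂ) = (l : ℕ) + 1 := by exact_mod_cast hl.symm
      rw [hp, hn]
      push_cast
      ring
    rw [h2, Complex.add_re, Complex.natCast_re]
    positivity
  have hK := kernelPT_mixed n z w j l hj hl hp
  -- Both closed forms of the mixed entry rewrite the single difference `ψ(p/2 + 3/2) - ψ(p/2)`.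
  rw [integral_mul_sqrt_eq_digamma hre] at hK
  refine ⟨laplaceJ_eq_Gamma hre, ?_, ?_, kernelPT_comm n z w l j⟩
  · rw [hK, digamma_sub_eq_nielsenBeta hre, mul_assoc]
  · rw [hK, digamma_sub_eq_harmonicFn hre]
    ring
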